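/- Let $n\ge 1$, $0<\lambda<n$, and let $b:\mathbb{R}^n\to\mathbb{R}$ be a measurable function. Cubes are assumed to have sides parallel to the coordinate axes, $|E|$ is the Lebesgue measure of $E$, $\log^+ s=\max\{\log s,0\}$, and $\Phi(s)=s(1+\log^+ s)$ for $s>0$, $\Phi(0)=0$. For a measurable function $f$ on $\mathbb{R}^n$ and a cube $Q$ put $$\|f\|_{L(1+\log^+L),Q}=\inf\Big\{\alpha>0:\ \frac1{|Q|}\int_Q\Phi\Big(\frac{|f(x)|}{\alpha}\Big)\,dx\le 1\Big\},$$ $$\|f\|_{WL(1+\log^+L),Q}=\inf\Big\{\alpha>0:\ \sup_{t>0}\frac1{|Q|}\,\frac{|\{x\in Q:|f(x)|>\alpha t\}|}{\frac1t\left(1+\log^+\frac1t\right)}\le 1\Big\}$$ (with $\inf\emptyset=\infty$), and $$\|f\|_{\mathcal M_{L(1+\log^+L),\lambda}}=\sup_Q|Q|^{\lambda/n}\|f\|_{L(1+\log^+L),Q},\qquad \|f\|_{W\mathcal M_{L(1+\log^+L),\lambda}}=\sup_Q|Q|^{\lambda/n}\|f\|_{WL(1+\log^+L),Q},$$ the suprema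 being taken over all cubes $Q$. The Zygmund--Morrey space $\mathcal M_{L(1+\log^+L),\lambda}$ and the weak Zygmund--Morrey space $W\mathcal M_{L(1+\log^+L),\lambda}$ consist of all measurable functions for which the corresponding quantity is finite. The maximal commutator is $$C_b(f)(x)=\sup_{Q\ni x}\frac1{|Q|}\int_Q|b(x)-b(y)|\,|f(y)|\,dy\qquad(x\in\mathbb{R}^n),$$ the supremum being taken over all cubes $Q$ containing $x$. Write $b\in BMO(\mathbb{R}^n)$ if $b$ is locally integrable and $\sup_Q\frac1{|Q|}\int_Q|b(y)-b_Q|\,dy<\infty$, where $b_Q=\frac1{|Q|}\int_Q b$. Then the following assertions are equivalent: (i) $b\in BMO(\mathbb{R}^n)$. (ii) The operator $C_b$ is bounded from $\mathcal M_{L(1+\log^+L),\lambda}$ to $W\mathcal M_{L(1+\log^+L),\lambda}$; that is, there is a constant $c<\infty$ such that for every $f\in\mathcal M_{L(1+\log^+L),\lambda}$ one has $C_b(f)\in W\mathcal M_{L(1+\log^+L),\lambda}$ and $$\|C_b(f)\|_{W\mathcal M_{L(1+\log^+L),\lambda}}\le c\,\|f\|_{\mathcal M_{L(1+\log^+L),\lambda}}.$$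 -/

import Mathlib

open MeasureTheory
open scoped ENNReal NNReal

noncomputable section

namespace ZygmundMorrey

variable {n : ℕ}

/-- The cube in `ℝⁿ` with sides parallel to the coordinate axes, centre `z` and side length `2 r`. -/
def cube (z : Fin n → ℝ) (r : ℝ) : Set (Fin n → ℝ) :=
  Set.univ.pi fun i => Set.Ioo (z i - r) (z i + r)

/-- The Young function `Φ(t) = t (1 + log⁺ t)`. -/
def youngFun (t : ℝ) : ℝ := t * (1 + Real.posLog t)

/-- Membership in `BMO(ℝⁿ)`: `b` is locally integrable and
`‖b‖_* = sup_Q |Q|⁻¹ ∫_Q |b - b_Q|` is finite. -/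
def MemBMO (b : (Fin n → ℝ) → ℝ) : Prop :=
  LocallyIntegrable b volume ∧
    (⨆ (z : Fin n → ℝ) (r : ℝ) (_ : 0 < r),
      (volume (cube z r))⁻¹ *
        ∫⁻ y in cube z r, ‖b y - ⨍ w in cube z r, b w‖ₑ) < ∞

/-- The maximal commutator `C_b(f)(x) = sup_{Q ∋ x} |Q|⁻¹ ∫_Q |b(x) - b(y)| |f(y)| dy`,
a function with values in `[0, ∞]`. -/
def maximalCommutator (b f : (Fin n → ℝ) → ℝ) (x : Fin n → ℝ) : ℝ≥0∞ :=
  ⨆ (z : Fin n → ℝ) (r : ℝ) (_ : 0 < r) (_ : x ∈ cube z r),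
    (volume (cube z r))⁻¹ * ∫⁻ y in cube z r, ‖b x - b y‖ₑ * ‖f y‖ₑ

/-- The `L(1 + log⁺ L)`-average of `f` over `Q`:
`inf {α > 0 : |Q|⁻¹ ∫_Q Φ(|f| / α) ≤ 1}` (equal to `∞` if there is no such `α`). -/
def zygmundAverage (f : (Fin n → ℝ) → ℝ) (Q : Set (Fin n → ℝ)) : ℝ≥0∞ :=
  ⨅ (α : ℝ≥0) (_ : 0 < α)
    (_ : (volume Q)⁻¹ * ∫⁻ x in Q, ENNReal.ofReal (youngFun (|f x| / α)) ≤ 1), (α : ℝ≥0∞)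

/-- The weak `L(1 + log⁺ L)`-average over `Q` of a function `g ≥ 0` (the value `∞` is allowed):
`inf {α > 0 : sup_{t > 0} |Q|⁻¹ |{x ∈ Q : g(x) > α t}| / (t⁻¹ (1 + log⁺ t⁻¹)) ≤ 1}`. -/
def weakZygmundAverage (g : (Fin n → ℝ) → ℝ≥0∞) (Q : Set (Fin n → ℝ)) : ℝ≥0∞ :=
  ⨅ (α : ℝ≥0) (_ : 0 < α)
    (_ : (⨆ (t : ℝ≥0) (_ : 0 < t),
      (volume Q)⁻¹ * (volume {x ∈ Q | (α : ℝ≥0∞) * (t : ℝ≥0∞) < g x} /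
        ENNReal.ofReal (youngFun (1 / (t : ℝ))))) ≤ 1), (α : ℝ≥0∞)

/-- The Zygmund-Morrey norm `sup_Q |Q|^{lam/n} ‖f‖_{L(1 + log⁺ L), Q}`. -/
def zygmundMorreyNorm (lam : ℝ) (f : (Fin n → ℝ) → ℝ) : ℝ≥0∞ :=
  ⨆ (z : Fin n → ℝ) (r : ℝ) (_ : 0 < r),
    volume (cube z r) ^ (lam / n) * zygmundAverage f (cube z r)

/-- The weak Zygmund-Morrey norm `sup_Q |Q|^{lam/n} ‖g‖_{WL(1 + log⁺ L), Q}` of `g ≥ 0`. -/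
def weakZygmundMorreyNorm (lam : ℝ) (g : (Fin n → ℝ) → ℝ≥0∞) : ℝ≥0∞ :=
  ⨆ (z : Fin n → ℝ) (r : ℝ) (_ : 0 < r),
    volume (cube z r) ^ (lam / n) * weakZygmundAverage g (cube z r)

/-- `f` belongs to the Zygmund-Morrey space (`AEMeasurable` is Lebesgue measurability). -/
def MemZygmundMorrey (lam : ℝ) (f : (Fin n → ℝ) → ℝ) : Prop :=
  AEMeasurable f volume ∧ zygmundMorreyNorm lam f < ∞

/-- The nonnegative function `g` belongs to the weak Zygmund-Morrey space. -/
def MemWeakZygmundMorrey (lam : ℝ) (g : (Fin n → ℝ) → ℝ≥0∞) : Prop :=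
  AEMeasurable g volume ∧ weakZygmundMorreyNorm lam g < ∞

/-- `T` is bounded from the Zygmund-Morrey space to the weak Zygmund-Morrey space. -/
def BoundedToWeak (lam : ℝ) (T : ((Fin n → ℝ) → ℝ) → (Fin n → ℝ) → ℝ≥0∞) : Prop :=
  ∃ C : ℝ≥0, ∀ f : (Fin n → ℝ) → ℝ, MemZygmundMorrey lam f →
    MemWeakZygmundMorrey lam (T f) ∧
      weakZygmundMorreyNorm lam (T f) ≤ C * zygmundMorreyNorm lam f

end ZygmundMorrey

end

namespace ZygmundMorrey

variable {n : ℕ}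

/-! ### Cubes -/

/-! Sufficiency. The John–Nirenberg inequality turns the BMO condition into the quantitative input
for all that follows: exp(c|b - b_Q|) has mean at most 6 over every cube
(`exists_lintegral_exp_le`). Fix Q of side 2r and split f = f₁ + f₂ with f₁ supported in 3Q.
Inserting b_{Q'} bounds C_b(f₁)(x) by |b(x) - b_{Q'}| times the mean of |f₁|, plus the mean of |b -
b_{Q'}||f₁|, over cubes Q' ∋ x. The first term is of weak type (1,1), by a Vitali argument summed
over the integer levels of |b(x) - b_{Q'}|. The second reduces to the maximal function of Φ by
Young's inequality uv ≤ Φ(u) + e^v. This is `exists_volume_maximalCommutator_le`. For f₂ only cubes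
larger than Q matter; there the Morrey bound makes the means of |f| decay like a power of the size,
which beats the logarithmic drift of the means of b (`maximalCommutator_compl_cube_le`), and
Chebyshev's inequality finishes.

Necessity. Test on f = 1_Q, whose norm is at most n/(n-λ) (2r)^λ because λ < n. The weak bound
leaves some x in Q with C_b(1_Q)(x) at most a constant independent of Q, and Q itself, as a
competitor in the supremum, bounds the mean of |b - b(x)| over Q. -/

lemma cube_eq_ball (z : Fin n → ℝ) {r : ℝ} (hr : 0 < r) : cube z r = Metric.ball z r := by
  simp [cube, ball_pi z hr, Real.ball_eq_Ioo]

lemma isOpen_cube (z : Fin n → ℝ) (r : ℝ) : IsOpen (cube z r) :=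
  isOpen_set_pi Set.finite_univ fun _ _ => isOpen_Ioo

lemma measurableSet_cube (z : Fin n → ℝ) (r : ℝ) : MeasurableSet (cube z r) :=
  (isOpen_cube z r).measurableSet

lemma mem_cube_self (z : Fin n → ℝ) {r : ℝ} (hr : 0 < r) : z ∈ cube z r := by
  rw [cube_eq_ball z hr]; exact Metric.mem_ball_self hr

lemma mem_cube_iff {z x : Fin n → ℝ} {r : ℝ} (hr : 0 < r) : x ∈ cube z r ↔ dist x z < r := by
  rw [cube_eq_ball z hr, Metric.mem_ball]

lemma volume_cube (z : Fin n → ℝ) {r : ℝ} (hr : 0 < r) :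
    volume (cube z r) = ENNReal.ofReal ((2 * r) ^ n) := by
  rw [cube_eq_ball z hr, Real.volume_pi_ball z hr, Fintype.card_fin]

lemma volume_cube_ne_zero (z : Fin n → ℝ) {r : ℝ} (hr : 0 < r) : volume (cube z r) ≠ 0 := by
  rw [volume_cube z hr]; simpa using (by positivity : 0 < (2 * r) ^ n)

lemma volume_cube_ne_top (z : Fin n → ℝ) {r : ℝ} (hr : 0 < r) : volume (cube z r) ≠ ∞ := by
  rw [volume_cube z hr]; exact ENNReal.ofReal_ne_top

lemma volume_cube_mul (z w : Fin n → ℝ) {r : ℝ} (hr : 0 < r) {k : ℕ} (hk : 0 < k) :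
    volume (cube z (k * r)) = (k : ℝ≥0∞) ^ n * volume (cube w r) := by
  have hk' : (0 : ℝ) < k := by exact_mod_cast hk
  rw [volume_cube z (by positivity), volume_cube w hr, mul_left_comm, mul_pow,
    ENNReal.ofReal_mul (by positivity), ENNReal.ofReal_pow hk'.le, ENNReal.ofReal_natCast]

lemma volume_cube_rpow (hn : n ≠ 0) (lam : ℝ) (z : Fin n → ℝ) {r : ℝ} (hr : 0 < r) :
    volume (cube z r) ^ (lam / n) = ENNReal.ofReal ((2 * r) ^ lam) := by
  have hn' : (n : ℝ) ≠ 0 := by exact_mod_cast hn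
  rw [volume_cube z hr, ENNReal.ofReal_rpow_of_pos (by positivity), ← Real.rpow_natCast,
    ← Real.rpow_mul (by positivity), mul_div_cancel₀ _ hn']

lemma cube_subset_cube {z w : Fin n → ℝ} {r s : ℝ} (hr : 0 < r) (h : dist w z + s ≤ r) :
    cube w s ⊆ cube z r := by
  rcases le_or_gt s 0 with hs | hs
  · intro x hx
    rcases Nat.eq_zero_or_pos n with rfl | hn
    · rw [mem_cube_iff hr, Subsingleton.elim x z, dist_self]; exact hr
    · have := hx ⟨0, hn⟩ trivial
      simp only [Set.mem_Ioo] at this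
      linarith [this.1, this.2]
  · rw [cube_eq_ball z hr, cube_eq_ball w hs]
    exact Metric.ball_subset_ball' (by linarith)

lemma cube_ae_eq_closedBall (z : Fin n → ℝ) {r : ℝ} (hr : 0 < r) :
    cube z r =ᵐ[volume] Metric.closedBall z r := by
  have : Metric.closedBall z r = Set.Icc (fun i => z i - r) (fun i => z i + r) := by
    rw [closedBall_pi z hr.le, ← Set.pi_univ_Icc]
    simp [Real.closedBall_eq_Icc]
  rw [this]
  exact Measure.univ_pi_Ioo_ae_eq_Icc

/-- A Vitali covering estimate: if every cube `Q = p` of a family `t` satisfies `|Q| ≤ ∫_Q h`, and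
`E` is covered by the sets `G q`, `q ∈ u`, as soon as the cubes `5 q`, `q ∈ u ⊆ t`, engulf the
cubes of `t`, then `|E| ≤ κ ∫ h` provided that `|G q| ≤ κ |q|`. -/
lemma vitali_bound (hn : n ≠ 0) {t : Set ((Fin n → ℝ) × ℝ)} (hpos : ∀ p ∈ t, 0 < p.2)
    {S : Set (Fin n → ℝ)} (hS : ∀ p ∈ t, cube p.1 p.2 ⊆ S) {h : (Fin n → ℝ) → ℝ≥0∞}
    (hfin : ∫⁻ y in S, h y ≠ ∞)
    (hh : ∀ p ∈ t, volume (cube p.1 p.2) ≤ ∫⁻ y in cube p.1 p.2, h y)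
    {G : (Fin n → ℝ) × ℝ → Set (Fin n → ℝ)} {κ : ℝ≥0∞}
    (hG : ∀ q ∈ t, volume (G q) ≤ κ * volume (cube q.1 q.2))
    {E : Set (Fin n → ℝ)}
    (hE : ∀ x ∈ E, ∃ p ∈ t, ∀ q ∈ t, cube p.1 p.2 ⊆ cube q.1 (5 * q.2) → x ∈ G q) :
    volume E ≤ κ * ∫⁻ y in S, h y := by
  set I := ∫⁻ y in S, h y with hI
  -- Vitali's lemma needs bounded radii: (2ρ)^n ≤ I, and 2ρ ≤ (2ρ)^n once ρ > 1.
  have hR : ∀ p ∈ t, p.2 ≤ max 1 I.toReal := by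
    intro p hp
    have h1 : volume (cube p.1 p.2) ≤ I := (hh p hp).trans (lintegral_mono_set (hS p hp))
    rw [volume_cube _ (hpos p hp)] at h1
    have h2 := (ENNReal.ofReal_le_iff_le_toReal hfin).1 h1
    have h3 := hpos p hp
    rcases le_or_gt p.2 1 with h4 | h4
    · exact h4.trans (le_max_left _ _)
    · have : (2 * p.2) ≤ (2 * p.2) ^ n := le_self_pow₀ (by linarith) hn
      exact le_max_of_le_right (by linarith)
  -- Dilation 4 for closed balls, so that the enlarged closed ball fits into the open cube dilated
  -- by 5.
  obtain ⟨u, hut, hdisj, hcov⟩ := Vitali.exists_disjoint_subfamily_covering_enlargement_closedBall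
    t Prod.fst Prod.snd _ hR 4 (by norm_num)
  have hdisj' : u.PairwiseDisjoint fun p => cube p.1 p.2 := by
    refine hdisj.mono_on fun p hp => ?_
    rw [cube_eq_ball _ (hpos p (hut hp))]
    exact Metric.ball_subset_closedBall
  have hcount : u.Countable := hdisj'.countable_of_isOpen (fun p _ => isOpen_cube _ _)
    fun p hp => ⟨p.1, mem_cube_self _ (hpos p (hut hp))⟩
  have hEu : E ⊆ ⋃ q ∈ u, G q := by
    intro x hx
    obtain ⟨p, hp, hpq⟩ := hE x hx
    obtain ⟨q, hq, hsub⟩ := hcov p hp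
    refine Set.mem_biUnion hq (hpq q (hut hq) ?_)
    have hq0 := hpos q (hut hq)
    rw [cube_eq_ball _ (hpos p hp), cube_eq_ball _ (by positivity)]
    exact Metric.ball_subset_closedBall.trans
      (hsub.trans (Metric.closedBall_subset_ball (by linarith)))
  calc volume E ≤ volume (⋃ q ∈ u, G q) := measure_mono hEu
    _ ≤ ∑' q : u, volume (G q) := measure_biUnion_le _ hcount _
    _ ≤ ∑' q : u, κ * ∫⁻ y in cube q.1.1 q.1.2, h y :=
        ENNReal.tsum_le_tsum fun q => (hG q (hut q.2)).trans (by gcongr; exact hh q (hut q.2))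
    _ = κ * ∫⁻ y in ⋃ q ∈ u, cube q.1 q.2, h y := by
        rw [ENNReal.tsum_mul_left, lintegral_biUnion hcount (fun _ _ => measurableSet_cube _ _)
          hdisj']
    _ ≤ κ * I := by
        gcongr
        exact lintegral_mono_set (Set.iUnion₂_subset fun q hq => hS q (hut hq))

/-- The weak type `(1,1)` estimate for the maximal function, in the form of a covering estimate. -/
lemma volume_le_of_maximal (hn : n ≠ 0) {S E : Set (Fin n → ℝ)} {h : (Fin n → ℝ) → ℝ≥0∞}
    (hE : ∀ x ∈ E, ∃ (z : Fin n → ℝ) (r : ℝ), 0 < r ∧ x ∈ cube z r ∧ cube z r ⊆ S ∧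
      volume (cube z r) ≤ ∫⁻ y in cube z r, h y) :
    volume E ≤ 5 ^ n * ∫⁻ y in S, h y := by
  by_cases hfin : ∫⁻ y in S, h y = ∞
  · rw [hfin, ENNReal.mul_top (by positivity)]; exact le_top
  refine vitali_bound hn (t := {p | 0 < p.2 ∧ cube p.1 p.2 ⊆ S ∧
    volume (cube p.1 p.2) ≤ ∫⁻ y in cube p.1 p.2, h y}) (fun p hp => hp.1) (fun p hp => hp.2.1)
    hfin (fun p hp => hp.2.2) (G := fun q => cube q.1 (5 * q.2)) ?_ ?_
  · intro q hq
    exact (volume_cube_mul q.1 q.1 hq.1 (k := 5) (by norm_num)).le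
  · intro x hx
    obtain ⟨z, r, hr, hxz, hsub, hle⟩ := hE x hx
    exact ⟨(z, r), ⟨hr, hsub, hle⟩, fun q _ hq => hq hxz⟩

/-! ### The Young function -/

lemma youngFun_zero : youngFun 0 = 0 := by simp [youngFun]

lemma youngFun_one : youngFun 1 = 1 := by simp [youngFun]

lemma le_youngFun {u : ℝ} (hu : 0 ≤ u) : u ≤ youngFun u := by
  have := Real.posLog_nonneg (x := u)
  unfold youngFun
  nlinarith

lemma youngFun_nonneg {u : ℝ} (hu : 0 ≤ u) : 0 ≤ youngFun u := hu.trans (le_youngFun hu)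

lemma youngFun_mono {u v : ℝ} (hu : 0 ≤ u) (huv : u ≤ v) : youngFun u ≤ youngFun v := by
  have := Real.posLog_nonneg (x := u)
  have := Real.posLog_le_posLog hu huv
  have := hu.trans huv
  unfold youngFun
  gcongr

/-- Since log⁺ is monotone, Φ is at least linear under contraction. This supplies the decay 1/t in
the local weak estimate. -/
lemma youngFun_mul_le {ε u : ℝ} (hε : 0 ≤ ε) (hε1 : ε ≤ 1) (hu : 0 ≤ u) :
    youngFun (ε * u) ≤ ε * youngFun u := by
  have := Real.posLog_le_posLog (mul_nonneg hε hu) (mul_le_of_le_one_left hu hε1)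
  unfold youngFun
  rw [mul_assoc]
  gcongr

lemma youngFun_of_le_one {u : ℝ} (hu : 0 ≤ u) (hu1 : u ≤ 1) : youngFun u = u := by
  have : Real.posLog u = 0 := by
    rw [Real.posLog_eq_zero_iff, abs_of_nonneg hu]; exact hu1
  simp [youngFun, this]

/-- Young's inequality for `Φ(t) = t (1 + log⁺ t)` and the exponential function. -/
lemma mul_le_youngFun_add_exp {u v : ℝ} (hu : 0 ≤ u) (hv : 0 ≤ v) :
    u * v ≤ youngFun u + Real.exp v := by
  rcases le_or_gt u 1 with h | h
  · have := youngFun_nonneg hu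
    have := Real.add_one_le_exp v
    nlinarith
  · have h1 := Real.add_one_le_exp (v - Real.log u)
    rw [Real.exp_sub, Real.exp_log (by linarith)] at h1
    have h2 : u * (v - Real.log u + 1) ≤ Real.exp v := by
      calc _ ≤ u * (Real.exp v / u) := by gcongr
        _ = _ := by field_simp
    have h3 : Real.posLog u = Real.log u := Real.posLog_eq_log (by rw [abs_of_nonneg hu]; exact h.le)
    unfold youngFun
    rw [h3]
    nlinarith

/-! ### Means over cubes and the John–Nirenberg inequality -/

/-- The mean value of `b` over the cube with centre `z` and side length `2 r`. -/
noncomputable def cubeMean (b : (Fin n → ℝ) → ℝ) (z : Fin n → ℝ) (r : ℝ) : ℝ := ⨍ w in cube z r, b w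

lemma integrableOn_cube {b : (Fin n → ℝ) → ℝ} (hb : LocallyIntegrable b volume)
    (z : Fin n → ℝ) {r : ℝ} (hr : 0 < r) : IntegrableOn b (cube z r) := by
  rw [cube_eq_ball z hr]
  exact (hb.integrableOn_isCompact (isCompact_closedBall z r)).mono_set Metric.ball_subset_closedBall

lemma enorm_cubeMean_sub_mul_le {b : (Fin n → ℝ) → ℝ} (hb : LocallyIntegrable b volume)
    (z : Fin n → ℝ) {r : ℝ} (hr : 0 < r) (a : ℝ) :
    ‖cubeMean b z r - a‖ₑ * volume (cube z r) ≤ ∫⁻ y in cube z r, ‖b y - a‖ₑ := by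
  have hfin := volume_cube_ne_top z hr
  have h1 : volume.real (cube z r) * (cubeMean b z r - a) = ∫ y in cube z r, (b y - a) := by
    rw [integral_sub (integrableOn_cube hb z hr) (integrableOn_const hfin), mul_sub,
      setIntegral_const, smul_eq_mul, cubeMean, ← smul_eq_mul, measure_smul_setAverage _ hfin]
  have h2 : ‖volume.real (cube z r)‖ₑ = volume (cube z r) := by
    rw [Real.enorm_of_nonneg measureReal_nonneg, ofReal_measureReal hfin]
  calc _ = ‖volume.real (cube z r) * (cubeMean b z r - a)‖ₑ := by rw [enorm_mul, h2, mul_comm]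
    _ ≤ _ := by rw [h1]; exact enorm_integral_le_lintegral_enorm _

lemma lintegral_sub_const_le (b : (Fin n → ℝ) → ℝ) (E : Set (Fin n → ℝ)) (m a : ℝ) :
    ∫⁻ y in E, ‖b y - a‖ₑ ≤ (∫⁻ y in E, ‖b y - m‖ₑ) + ‖m - a‖ₑ * volume E := by
  calc _ ≤ ∫⁻ y in E, (‖b y - m‖ₑ + ‖m - a‖ₑ) := by
        refine lintegral_mono fun y => ?_
        calc ‖b y - a‖ₑ = ‖(b y - m) + (m - a)‖ₑ := by ring_nf
          _ ≤ _ := enorm_add_le _ _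
    _ = _ := by rw [lintegral_add_right _ measurable_const, setLIntegral_const]

/-- Lebesgue differentiation for closed sup-norm balls, carried over to open cubes because their
boundaries are null. -/
lemma ae_tendsto_cube_average {F : (Fin n → ℝ) → ℝ≥0∞} (hF : AEMeasurable F volume)
    (hfin : ∫⁻ y, F y ≠ ∞) {ρ : ℕ → ℝ} (hpos : ∀ k, 0 < ρ k)
    (hρ : Filter.Tendsto ρ Filter.atTop (nhds 0)) :
    ∀ᵐ x, Filter.Tendsto (fun k => (∫⁻ y in cube x (ρ k), F y) / volume (cube x (ρ k)))
      Filter.atTop (nhds (F x)) := by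
  filter_upwards [VitaliFamily.ae_tendsto_lintegral_div
    (IsUnifLocDoublingMeasure.vitaliFamily (volume : Measure (Fin n → ℝ)) 1) hF hfin] with x hx
  have h1 := IsUnifLocDoublingMeasure.tendsto_closedBall_filterAt
    (volume : Measure (Fin n → ℝ)) (K := 1) (x := x) (l := Filter.atTop) (fun _ : ℕ => x) ρ
    (tendsto_nhdsWithin_iff.2 ⟨hρ, Filter.Eventually.of_forall hpos⟩)
    (Filter.Eventually.of_forall fun k => Metric.mem_closedBall_self (by simpa using (hpos k).le))
  refine (hx.comp h1).congr fun k => ?_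
  have h2 := cube_ae_eq_closedBall x (hpos k)
  simp only [Function.comp]
  rw [setLIntegral_congr h2, measure_congr h2]

/-- The inductive step of the John–Nirenberg inequality. -/
lemma john_nirenberg_step (hn : n ≠ 0) {b : (Fin n → ℝ) → ℝ} (hb : LocallyIntegrable b volume)
    {K : ℝ} (hK : 0 < K) {s : ℝ} (hs : 0 ≤ s) {κ : ℝ≥0∞} (z : Fin n → ℝ) {r : ℝ} (hr : 0 < r)
    (hκ : ∀ (w : Fin n → ℝ) (ρ : ℝ), 0 < ρ →
      volume {x ∈ cube w ρ | s < |b x - cubeMean b w ρ|} ≤ κ * volume (cube w ρ))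
    (hint : ∫⁻ y in cube z (2 * r), ENNReal.ofReal K⁻¹ * ‖b y - cubeMean b z r‖ₑ <
      volume (cube z r)) :
    volume {x ∈ cube z r | s + K < |b x - cubeMean b z r|} ≤ κ * 5 ^ n *
      ∫⁻ y in cube z (2 * r), ENNReal.ofReal K⁻¹ * ‖b y - cubeMean b z r‖ₑ := by
  set m := cubeMean b z r with hm
  set h : (Fin n → ℝ) → ℝ≥0∞ := fun y => ENNReal.ofReal K⁻¹ * ‖b y - m‖ₑ with hh
  have hbm : AEMeasurable b volume := hb.aestronglyMeasurable.aemeasurable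
  have hhm : AEMeasurable h volume := (hbm.sub_const m).enorm.const_mul _
  -- The ratio 5 matches the Vitali enlargement: if a cube is the first on which h has mean at least
  -- 1, its enlargement is the preceding cube, where the mean is still below 1.
  set ρ : ℕ → ℝ := fun k => r / 5 ^ k with hρ
  have hρpos : ∀ k, 0 < ρ k := fun k => by positivity
  have hρ0 : Filter.Tendsto ρ Filter.atTop (nhds 0) := by
    have := (tendsto_pow_atTop_nhds_zero_of_lt_one (r := (1 / 5 : ℝ)) (by norm_num)
      (by norm_num)).const_mul r
    simpa [hρ, div_eq_mul_inv] using this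
  have hρr : ∀ k, ρ k ≤ r := fun k => div_le_self hr.le (one_le_pow₀ (by norm_num))
  have hsub : ∀ x ∈ cube z r, ∀ k, cube x (ρ k) ⊆ cube z (2 * r) := by
    intro x hx k
    refine cube_subset_cube (by positivity) ?_
    have := (mem_cube_iff hr).1 hx
    linarith [hρr k]
  have hdiff := ae_tendsto_cube_average (F := (cube z (2 * r)).indicator h)
    (hhm.indicator (measurableSet_cube _ _))
    (by rw [lintegral_indicator (measurableSet_cube _ _)]; exact (hint.trans_le le_top).ne) hρpos hρ0
  set A := {x | Filter.Tendsto (fun k => (∫⁻ y in cube x (ρ k), (cube z (2 * r)).indicator h y) /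
    volume (cube x (ρ k))) Filter.atTop (nhds ((cube z (2 * r)).indicator h x))} with hA
  have hmeas : volume {x ∈ cube z r | s + K < |b x - m|} =
      volume ({x ∈ cube z r | s + K < |b x - m|} ∩ A) := by
    refine measure_congr ?_
    filter_upwards [hdiff] with x hx
    have hx' : x ∈ A := hx
    exact propext ⟨fun h => ⟨h, hx'⟩, fun h => h.1⟩
  rw [hmeas]
  refine vitali_bound hn (t := {p | p.1 ∈ cube z r ∧ 0 < p.2 ∧ cube p.1 p.2 ⊆ cube z (2 * r) ∧
      volume (cube p.1 p.2) ≤ ∫⁻ y in cube p.1 p.2, h y ∧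
      ∫⁻ y in cube p.1 (5 * p.2), h y < volume (cube p.1 (5 * p.2))})
    (fun p hp => hp.2.1) (fun p hp => hp.2.2.1) (hint.trans_le le_top).ne
    (fun p hp => hp.2.2.2.1)
    (G := fun q => {x ∈ cube q.1 (5 * q.2) | s < |b x - cubeMean b q.1 (5 * q.2)|}) ?_ ?_
  · intro q hq
    have := volume_cube_mul q.1 q.1 hq.2.1 (k := 5) (by norm_num)
    refine (hκ q.1 (5 * q.2) (by linarith [hq.2.1])).trans ?_
    rw [mul_assoc]
    gcongr
    exact this.le
  · rintro x ⟨⟨hxz, hxs⟩, hxA⟩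
    have hex : ∃ k, volume (cube x (ρ k)) ≤ ∫⁻ y in cube x (ρ k), h y := by
      have h1 : 1 < (cube z (2 * r)).indicator h x := by
        rw [Set.indicator_of_mem (hsub x hxz 0 (mem_cube_self x (hρpos 0)))]
        simp only [hh]
        rw [Real.enorm_eq_ofReal_abs, ← ENNReal.ofReal_mul (by positivity),
          ENNReal.one_lt_ofReal, inv_mul_eq_div, one_lt_div hK]
        linarith
      obtain ⟨k, hk⟩ := ((show Filter.Tendsto _ _ _ from hxA).eventually (lt_mem_nhds h1)).exists
      refine ⟨k, ?_⟩
      rw [ENNReal.lt_div_iff_mul_lt (Or.inl (volume_cube_ne_zero x (hρpos k)))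
        (Or.inl (volume_cube_ne_top x (hρpos k))), one_mul] at hk
      refine hk.le.trans (lintegral_mono fun y => Set.indicator_le_self _ _ _)
    classical
    -- Stopping at the initial radius r is excluded by `hint`.
    have h0 : Nat.find hex ≠ 0 := by
      intro h0
      have h1 := Nat.find_spec hex
      rw [h0] at h1
      have h2 : volume (cube x (ρ 0)) = volume (cube z r) := by
        simp [hρ, volume_cube _ hr]
      rw [h2] at h1
      exact absurd (h1.trans (lintegral_mono_set (hsub x hxz 0))) (not_le.2 hint)
    obtain ⟨j, hj⟩ := Nat.exists_eq_succ_of_ne_zero h0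
    have hj5 : 5 * ρ (j + 1) = ρ j := by
      simp only [hρ, pow_succ]; field_simp
    refine ⟨(x, ρ (j + 1)), ⟨hxz, hρpos _, hsub x hxz _, ?_, ?_⟩, ?_⟩
    · have := Nat.find_spec hex
      rwa [hj] at this
    · have := Nat.find_min hex (m := j) (by omega)
      simp only [hj5]
      exact not_le.1 this
    -- On the enlarged cube h has mean below 1, so the mean of b there is within K of m. From |b(x)
    -- - m| > s + K there remains an oscillation above s.
    · rintro ⟨w, σ⟩ ⟨-, hσ, -, -, hlt⟩ hsubq
      refine ⟨hsubq (mem_cube_self x (hρpos _)), ?_⟩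
      simp only at hlt hσ ⊢
      have h5 : 0 < 5 * σ := by positivity
      have h1 := enorm_cubeMean_sub_mul_le hb w h5 m
      rw [hh, lintegral_const_mul' _ _ ENNReal.ofReal_ne_top] at hlt
      have h2 : ENNReal.ofReal K⁻¹ * ‖cubeMean b w (5 * σ) - m‖ₑ < 1 := by
        by_contra hcon
        rw [not_lt] at hcon
        refine absurd hlt (not_lt.2 ?_)
        calc volume (cube w (5 * σ)) = 1 * volume (cube w (5 * σ)) := (one_mul _).symm
          _ ≤ ENNReal.ofReal K⁻¹ * ‖cubeMean b w (5 * σ) - m‖ₑ * volume (cube w (5 * σ)) := by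
            gcongr
          _ ≤ _ := by rw [mul_assoc]; gcongr
      rw [Real.enorm_eq_ofReal_abs, ← ENNReal.ofReal_mul (by positivity),
          ENNReal.ofReal_lt_one, inv_mul_eq_div, div_lt_one hK] at h2
      have h3 := abs_sub_le (b x) (cubeMean b w (5 * σ)) m
      linarith

/-- The John–Nirenberg inequality, in the form of a distributional estimate. -/
lemma john_nirenberg (hn : n ≠ 0) {b : (Fin n → ℝ) → ℝ} (hb : LocallyIntegrable b volume)
    {N : ℝ≥0} (hN : ∀ (z : Fin n → ℝ) (r : ℝ), 0 < r →
      ∫⁻ y in cube z r, ‖b y - cubeMean b z r‖ₑ ≤ N * volume (cube z r)) :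
    ∃ K : ℝ, 0 < K ∧ ∀ (k : ℕ) (z : Fin n → ℝ) (r : ℝ), 0 < r →
      volume {x ∈ cube z r | K * k < |b x - cubeMean b z r|} ≤
        (2⁻¹ : ℝ≥0∞) ^ k * volume (cube z r) := by
  -- The integral of |b - b_Q| over 2Q is at most 2·4^n N|Q| and the covering costs 5^n; this K
  -- makes 2·20^n N / K ≤ 1/2, so each rise of the level by K halves the measure.
  set K : ℝ := 4 * 20 ^ n * (N + 1) with hKdef
  have hK : 0 < K := by positivity
  have hint : ∀ (z : Fin n → ℝ) (r : ℝ), 0 < r →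
      5 ^ n * ∫⁻ y in cube z (2 * r), ENNReal.ofReal K⁻¹ * ‖b y - cubeMean b z r‖ₑ ≤
        2⁻¹ * volume (cube z r) := by
    intro z r hr
    have h2r : 0 < 2 * r := by positivity
    have hvol : volume (cube z (2 * r)) = 2 ^ n * volume (cube z r) :=
      volume_cube_mul z z hr (k := 2) (by norm_num)
    have hsub : cube z r ⊆ cube z (2 * r) := cube_subset_cube h2r (by rw [dist_self]; linarith)
    have h1 : ‖cubeMean b z r - cubeMean b z (2 * r)‖ₑ ≤ N * 2 ^ n := by
      have := (enorm_cubeMean_sub_mul_le hb z hr (cubeMean b z (2 * r))).trans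
        ((lintegral_mono_set hsub).trans (hN z (2 * r) h2r))
      rw [hvol, ← mul_assoc] at this
      exact (ENNReal.mul_le_mul_iff_left (volume_cube_ne_zero z hr) (volume_cube_ne_top z hr)).1 this
    have h2 : ∫⁻ y in cube z (2 * r), ‖b y - cubeMean b z r‖ₑ ≤
        2 * 4 ^ n * N * volume (cube z r) := by
      refine (lintegral_sub_const_le b _ (cubeMean b z (2 * r)) _).trans ?_
      rw [enorm_sub_rev]
      refine (add_le_add (hN z (2 * r) h2r) (mul_le_mul_left h1 _)).trans ?_
      rw [hvol, show (4 : ℝ≥0∞) ^ n = 2 ^ n * 2 ^ n by rw [← mul_pow]; norm_num]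
      have h3 : (N : ℝ≥0∞) * (2 ^ n * volume (cube z r)) ≤
          N * 2 ^ n * (2 ^ n * volume (cube z r)) := by
        rw [mul_assoc]
        gcongr
        exact le_mul_of_one_le_left' (one_le_pow₀ (by norm_num))
      refine (add_le_add_left h3 _).trans (le_of_eq ?_)
      ring
    rw [lintegral_const_mul' _ _ ENNReal.ofReal_ne_top]
    refine (mul_le_mul_right (mul_le_mul_right h2 _) _).trans ?_
    have h4 : (5 : ℝ≥0∞) ^ n * (ENNReal.ofReal K⁻¹ * (2 * 4 ^ n * N * volume (cube z r))) =
        (ENNReal.ofReal K⁻¹ * (2 * 20 ^ n * N)) * volume (cube z r) := by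
      rw [show (20 : ℝ≥0∞) ^ n = 5 ^ n * 4 ^ n by rw [← mul_pow]; norm_num]
      ring
    rw [h4]
    gcongr
    have h5 : (2 * 20 ^ n * N : ℝ≥0∞) = ENNReal.ofReal (2 * 20 ^ n * N) := by
      rw [ENNReal.ofReal_mul (by positivity), ENNReal.ofReal_mul (by positivity),
        ENNReal.ofReal_pow (by positivity)]
      simp
    have h6 : (2⁻¹ : ℝ≥0∞) = ENNReal.ofReal 2⁻¹ := by
      rw [ENNReal.ofReal_inv_of_pos (by norm_num)]; simp
    rw [h5, h6, ← ENNReal.ofReal_mul (by positivity)]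
    refine ENNReal.ofReal_le_ofReal ?_
    rw [inv_mul_eq_div, div_le_iff₀ hK, hKdef]
    have : (0 : ℝ) < 20 ^ n := by positivity
    nlinarith [N.coe_nonneg]
  refine ⟨K, hK, fun k => ?_⟩
  induction k with
  | zero =>
    intro z r hr
    rw [pow_zero, one_mul]
    exact measure_mono fun x hx => hx.1
  | succ k ih =>
    intro z r hr
    have h1 := hint z r hr
    have h2 : ∫⁻ y in cube z (2 * r), ENNReal.ofReal K⁻¹ * ‖b y - cubeMean b z r‖ₑ <
        volume (cube z r) := by
      refine (le_mul_of_one_le_left' (one_le_pow₀ (by norm_num : (1 : ℝ≥0∞) ≤ 5))).trans_lt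
        (h1.trans_lt ?_)
      rw [mul_comm, ← div_eq_mul_inv]
      exact ENNReal.half_lt_self (volume_cube_ne_zero z hr) (volume_cube_ne_top z hr)
    have h3 := john_nirenberg_step hn hb hK (s := K * k) (by positivity) z hr ih h2
    rw [Nat.cast_succ, mul_add, mul_one]
    refine h3.trans ?_
    rw [mul_assoc, pow_succ, mul_assoc]
    gcongr

/-- The John–Nirenberg inequality, in the form of exponential integrability. -/
lemma exists_lintegral_exp_le (hn : n ≠ 0) {b : (Fin n → ℝ) → ℝ}
    (hb : LocallyIntegrable b volume)
    {N : ℝ≥0} (hN : ∀ (z : Fin n → ℝ) (r : ℝ), 0 < r →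
      ∫⁻ y in cube z r, ‖b y - cubeMean b z r‖ₑ ≤ N * volume (cube z r)) :
    ∃ c : ℝ, 0 < c ∧ ∀ (z : Fin n → ℝ) (r : ℝ), 0 < r →
      ∫⁻ y in cube z r, ENNReal.ofReal (Real.exp (c * |b y - cubeMean b z r|)) ≤
        6 * volume (cube z r) := by
  obtain ⟨K, hK, hJN⟩ := john_nirenberg hn hb hN
  have hlog : 0 < Real.log (4 / 3) := Real.log_pos (by norm_num)
  have hbm : AEMeasurable b volume := hb.aestronglyMeasurable.aemeasurable
  -- The exponential is at most (4/3)^(k+1) where Kk < |b - m| ≤ K(k+1). Against the decay 2^(-k)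
  -- this gives ratio 2/3 and total (4/3)(1 + 3) = 16/3 ≤ 6.
  refine ⟨Real.log (4 / 3) / K, by positivity, fun z r hr => ?_⟩
  set m := cubeMean b z r
  set q : ℝ≥0∞ := ENNReal.ofReal (4 / 3) with hq
  have hcover : ∀ y, ENNReal.ofReal (Real.exp (Real.log (4 / 3) / K * |b y - m|)) ≤
      q + ∑' k : ℕ, {y | K * k < |b y - m|}.indicator (fun _ => q ^ (k + 1)) y := by
    intro y
    rcases (abs_nonneg (b y - m)).eq_or_lt with h0 | h0
    · rw [← h0, mul_zero, Real.exp_zero]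
      exact le_add_right (ENNReal.ofReal_le_ofReal (by norm_num))
    · obtain ⟨k, hk⟩ := Nat.exists_eq_succ_of_ne_zero (Nat.ceil_pos.2 (div_pos h0 hK)).ne'
      have h1 : K * k < |b y - m| := by
        have : k < ⌈|b y - m| / K⌉₊ := by omega
        rw [Nat.lt_ceil, lt_div_iff₀ hK] at this
        linarith
      have h2 : |b y - m| / K ≤ (k + 1 : ℕ) := Nat.ceil_le.1 hk.le
      refine le_add_left (le_trans ?_ (ENNReal.le_tsum k))
      rw [Set.indicator_of_mem (show y ∈ {y | K * k < |b y - m|} from h1), hq,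
        ← ENNReal.ofReal_pow (by norm_num)]
      refine ENNReal.ofReal_le_ofReal ?_
      rw [← Real.exp_log (show (0 : ℝ) < (4 / 3) ^ (k + 1) by positivity), Real.log_pow]
      refine Real.exp_le_exp.2 ?_
      rw [div_mul_eq_mul_div, mul_div_assoc, mul_comm]
      gcongr
  have hmeas : ∀ k : ℕ, NullMeasurableSet {y | K * k < |b y - m|} (volume.restrict (cube z r)) :=
    fun k => nullMeasurableSet_lt aemeasurable_const (hbm.sub_const m).restrict.abs
  have hq2 : q * 2⁻¹ = ENNReal.ofReal (2 / 3) := by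
    rw [hq, show (2⁻¹ : ℝ≥0∞) = ENNReal.ofReal 2⁻¹ by
      rw [ENNReal.ofReal_inv_of_pos (by norm_num)]; simp, ← ENNReal.ofReal_mul (by norm_num)]
    norm_num
  calc _ ≤ ∫⁻ y in cube z r,
        (q + ∑' k : ℕ, {y | K * k < |b y - m|}.indicator (fun _ => q ^ (k + 1)) y) :=
        lintegral_mono hcover
    _ = q * volume (cube z r) +
        ∑' k : ℕ, q ^ (k + 1) * volume {y ∈ cube z r | K * k < |b y - m|} := by
        rw [lintegral_add_left measurable_const, setLIntegral_const,
          lintegral_tsum fun k => aemeasurable_const.indicator₀ (hmeas k)]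
        congr 2 with k
        rw [lintegral_indicator_const₀ (hmeas k), Measure.restrict_apply₀ (hmeas k), Set.inter_comm]
        rfl
    _ ≤ q * volume (cube z r) +
        ∑' k : ℕ, q * volume (cube z r) * ENNReal.ofReal (2 / 3) ^ k := by
        refine add_le_add le_rfl (ENNReal.tsum_le_tsum fun k => ?_)
        calc _ ≤ q ^ (k + 1) * ((2⁻¹ : ℝ≥0∞) ^ k * volume (cube z r)) := by
              gcongr; exact hJN k z r hr
          _ = _ := by rw [← hq2, mul_pow]; ring
    _ = (q * 4) * volume (cube z r) := by
        rw [ENNReal.tsum_mul_left, ENNReal.tsum_geometric]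
        have : (1 - ENNReal.ofReal (2 / 3))⁻¹ = 3 := by
          rw [← ENNReal.ofReal_one, ← ENNReal.ofReal_sub _ (by norm_num),
            ← ENNReal.ofReal_inv_of_pos (by norm_num)]
          norm_num
        rw [this]
        ring
    _ ≤ 6 * volume (cube z r) := by
        gcongr
        rw [hq, show (4 : ℝ≥0∞) = ENNReal.ofReal 4 by simp, show (6 : ℝ≥0∞) = ENNReal.ofReal 6 by simp,
          ← ENNReal.ofReal_mul (by norm_num)]
        exact ENNReal.ofReal_le_ofReal (by norm_num)

/-! ### Consequences of exponential integrability -/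

lemma ofReal_mul_abs {c : ℝ} (hc : 0 ≤ c) (a : ℝ) :
    ENNReal.ofReal (c * |a|) = ENNReal.ofReal c * ‖a‖ₑ := by
  rw [ENNReal.ofReal_mul hc, Real.enorm_eq_ofReal_abs]

/-- The tangent-line inequality τ + 1 ≤ m + e^(τ-m) with τ = c|b - a|, integrated; it plays the role
of Jensen's inequality. When τ has mean at least m over E, the extra |E| on the left survives and is
bounded by the exponential term. -/
lemma lintegral_mul_abs_add_volume_le {b : (Fin n → ℝ) → ℝ} (hb : AEMeasurable b volume)
    {c m : ℝ} (hc : 0 ≤ c) (hm : 0 ≤ m) (E : Set (Fin n → ℝ)) (a : ℝ) :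
    (∫⁻ y in E, ENNReal.ofReal (c * |b y - a|)) + volume E ≤ ENNReal.ofReal m * volume E +
      ENNReal.ofReal (Real.exp (-m)) * ∫⁻ y in E, ENNReal.ofReal (Real.exp (c * |b y - a|)) := by
  have hE : AEMeasurable (fun y => ENNReal.ofReal (Real.exp (c * |b y - a|)))
      (volume.restrict E) :=
    (((hb.sub_const a).restrict.abs.const_mul c).exp).ennreal_ofReal
  calc _ = ∫⁻ y in E, (ENNReal.ofReal (c * |b y - a|) + 1) := by
        rw [lintegral_add_right _ measurable_const, setLIntegral_const, one_mul]
    _ ≤ ∫⁻ y in E, (ENNReal.ofReal m +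
          ENNReal.ofReal (Real.exp (-m)) * ENNReal.ofReal (Real.exp (c * |b y - a|))) := by
        refine lintegral_mono fun y => ?_
        have h0 : 0 ≤ c * |b y - a| := by positivity
        rw [← ENNReal.ofReal_one, ← ENNReal.ofReal_add h0 zero_le_one,
          ← ENNReal.ofReal_mul (Real.exp_nonneg _), ← ENNReal.ofReal_add hm (by positivity),
          ← Real.exp_add]
        refine ENNReal.ofReal_le_ofReal ?_
        have := Real.add_one_le_exp (-m + c * |b y - a|)
        linarith
    _ = _ := by
        rw [lintegral_add_left measurable_const, setLIntegral_const, lintegral_const_mul'' _ hE]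

lemma ofReal_mul_abs_cubeMean_sub_le {b : (Fin n → ℝ) → ℝ} (hb : LocallyIntegrable b volume)
    {c : ℝ} (hc : 0 ≤ c) (z : Fin n → ℝ) {r : ℝ} (hr : 0 < r) (a : ℝ) :
    ENNReal.ofReal (c * |cubeMean b z r - a|) * volume (cube z r) ≤
      ∫⁻ y in cube z r, ENNReal.ofReal (c * |b y - a|) := by
  simp_rw [ofReal_mul_abs hc]
  rw [lintegral_const_mul' _ _ ENNReal.ofReal_ne_top, mul_assoc]
  gcongr
  exact enorm_cubeMean_sub_mul_le hb z hr a

/-- The means of a function of bounded mean oscillation over nested cubes differ at most by the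
logarithm of the ratio of their volumes. -/
lemma ofReal_mul_abs_cubeMean_sub_cubeMean_le {b : (Fin n → ℝ) → ℝ}
    (hb : LocallyIntegrable b volume) {c : ℝ} (hc : 0 ≤ c)
    (hexp : ∀ (z : Fin n → ℝ) (r : ℝ), 0 < r →
      ∫⁻ y in cube z r, ENNReal.ofReal (Real.exp (c * |b y - cubeMean b z r|)) ≤
        6 * volume (cube z r))
    {z w : Fin n → ℝ} {r ρ m : ℝ} (hr : 0 < r) (hρ : 0 < ρ) (hm : 0 ≤ m)
    (hsub : cube w ρ ⊆ cube z r)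
    (hvol : volume (cube z r) ≤ ENNReal.ofReal (Real.exp m) * volume (cube w ρ)) :
    ENNReal.ofReal (c * |cubeMean b w ρ - cubeMean b z r|) ≤ ENNReal.ofReal m + 6 := by
  have hbm : AEMeasurable b volume := hb.aestronglyMeasurable.aemeasurable
  refine (ENNReal.mul_le_mul_iff_left (volume_cube_ne_zero w hρ) (volume_cube_ne_top w hρ)).1 ?_
  refine (ofReal_mul_abs_cubeMean_sub_le hb hc w hρ _).trans ?_
  refine le_self_add.trans ((lintegral_mul_abs_add_volume_le hbm hc hm (cube w ρ) _).trans ?_)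
  rw [add_mul]
  refine add_le_add le_rfl ?_
  -- The factor e^(-m) cancels the loss e^m of passing from the small cube to the large one.
  calc _ ≤ ENNReal.ofReal (Real.exp (-m)) *
        (6 * (ENNReal.ofReal (Real.exp m) * volume (cube w ρ))) := by
        gcongr
        exact (lintegral_mono_set hsub).trans ((hexp z r hr).trans (by gcongr))
    _ = (ENNReal.ofReal (Real.exp (-m)) * ENNReal.ofReal (Real.exp m)) *
        (6 * volume (cube w ρ)) := by ring
    _ = _ := by
        rw [← ENNReal.ofReal_mul (Real.exp_nonneg _), ← Real.exp_add]
        simp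

lemma volume_le_setLIntegral {g : (Fin n → ℝ) → ℝ≥0∞} (hg : AEMeasurable g volume)
    (E : Set (Fin n → ℝ)) (hE : MeasurableSet E) :
    volume {x ∈ E | 1 ≤ g x} ≤ ∫⁻ x in E, g x := by
  have := mul_meas_ge_le_lintegral₀ (μ := volume.restrict E) hg.restrict 1
  rw [one_mul, Measure.restrict_apply' hE] at this
  refine (measure_mono ?_).trans this
  exact fun x hx => ⟨hx.2, hx.1⟩

/-- The points of a cube `P` that lie in a cube `R ⊆ P` with `|b(x) - b_R| ≥ j` form a set of
exponentially small measure. -/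
lemma volume_large_oscillation_le (hn : n ≠ 0) {b : (Fin n → ℝ) → ℝ}
    (hb : LocallyIntegrable b volume) {c : ℝ} (hc : 0 ≤ c)
    (hexp : ∀ (z : Fin n → ℝ) (r : ℝ), 0 < r →
      ∫⁻ y in cube z r, ENNReal.ofReal (Real.exp (c * |b y - cubeMean b z r|)) ≤
        6 * volume (cube z r))
    (z : Fin n → ℝ) {r : ℝ} (hr : 0 < r) {j : ℝ} (hj : 0 ≤ j) :
    volume {x ∈ cube z r | ∃ (w : Fin n → ℝ) (ρ : ℝ), 0 < ρ ∧ cube w ρ ⊆ cube z r ∧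
      x ∈ cube w ρ ∧ j ≤ |b x - cubeMean b w ρ|} ≤
        ENNReal.ofReal (Real.exp (-(c / 2 * j))) * (6 * (1 + 5 ^ n)) * volume (cube z r) := by
  have hbm : AEMeasurable b volume := hb.aestronglyMeasurable.aemeasurable
  set m := cubeMean b z r with hm
  set e := ENNReal.ofReal (Real.exp (-(c / 2 * j))) with he
  set g : (Fin n → ℝ) → ℝ≥0∞ := fun y => e * ENNReal.ofReal (Real.exp (c * |b y - m|)) with hg
  have hgm : AEMeasurable g volume :=
    (((hbm.sub_const m).abs.const_mul c).exp).ennreal_ofReal.const_mul _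
  have hgint : ∀ E : Set (Fin n → ℝ), ∫⁻ y in E, g y =
      e * ∫⁻ y in E, ENNReal.ofReal (Real.exp (c * |b y - m|)) := fun E =>
    lintegral_const_mul' _ _ ENNReal.ofReal_ne_top
  have hgP : ∫⁻ y in cube z r, g y ≤ e * 6 * volume (cube z r) := by
    rw [hgint, mul_assoc]
    gcongr
    exact hexp z r hr
  set A₁ := {x ∈ cube z r | 1 ≤ g x} with hA₁
  set A₂ := {x | ∃ (w : Fin n → ℝ) (ρ : ℝ), 0 < ρ ∧ x ∈ cube w ρ ∧ cube w ρ ⊆ cube z r ∧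
      volume (cube w ρ) ≤ ∫⁻ y in cube w ρ, g y} with hA₂
  have h1 : volume A₁ ≤ e * 6 * volume (cube z r) :=
    (volume_le_setLIntegral hgm _ (measurableSet_cube z r)).trans hgP
  have h2 : volume A₂ ≤ 5 ^ n * (e * 6 * volume (cube z r)) :=
    (volume_le_of_maximal hn (S := cube z r) (fun x hx => hx)).trans (by gcongr)
  calc _ ≤ volume (A₁ ∪ A₂) := by
        refine measure_mono ?_
        rintro x ⟨hxz, w, ρ, hρ, hsub, hxw, hjx⟩
        have htri := abs_sub_le (b x) m (cubeMean b w ρ)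
        rw [abs_sub_comm m] at htri
        -- Either |b(x) - b_P| or |b_R - b_P| is at least j/2: Chebyshev handles the first case, the
        -- maximal function of g the second.
        rcases le_total (j / 2) |b x - m| with h | h
        · refine Or.inl ⟨hxz, ?_⟩
          simp only [hg, he]
          rw [← ENNReal.ofReal_mul (Real.exp_nonneg _), ← Real.exp_add, ENNReal.one_le_ofReal,
            Real.one_le_exp_iff]
          nlinarith
        · refine Or.inr ⟨w, ρ, hρ, hxw, hsub, ?_⟩
          have h3 := lintegral_mul_abs_add_volume_le hbm hc (m := c / 2 * j) (by positivity)
            (cube w ρ) m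
          rw [← he, ← hgint] at h3
          have h4 : ENNReal.ofReal (c / 2 * j) * volume (cube w ρ) ≤
              ∫⁻ y in cube w ρ, ENNReal.ofReal (c * |b y - m|) := by
            refine le_trans ?_ (ofReal_mul_abs_cubeMean_sub_le hb hc w hρ m)
            gcongr ENNReal.ofReal ?_ * _
            nlinarith
          exact (ENNReal.add_le_add_iff_left (ENNReal.mul_ne_top ENNReal.ofReal_ne_top
            (volume_cube_ne_top w hρ))).1 ((add_le_add_left h4 _).trans h3)
    _ ≤ e * 6 * volume (cube z r) + 5 ^ n * (e * 6 * volume (cube z r)) :=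
        (measure_union_le _ _).trans (add_le_add h1 h2)
    _ = _ := by ring

/-! ### The weak type estimate for the maximal commutator -/

lemma tsum_exp_mul_ne_top {c : ℝ} (hc : 0 < c) :
    ∑' j : ℕ, ENNReal.ofReal (Real.exp (-(c * j))) * ((j : ℝ≥0∞) + 1) ≠ ∞ := by
  have hx : ‖Real.exp (-c)‖ < 1 := by
    rw [Real.norm_of_nonneg (Real.exp_nonneg _), Real.exp_lt_one_iff]; linarith
  have hs := (summable_pow_mul_geometric_of_norm_lt_one 1 hx).add
    (summable_geometric_of_norm_lt_one hx)
  have : (fun j : ℕ => ENNReal.ofReal (Real.exp (-(c * j))) * ((j : ℝ≥0∞) + 1)) =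
      fun j : ℕ => ENNReal.ofReal ((j : ℝ) ^ 1 * Real.exp (-c) ^ j + Real.exp (-c) ^ j) := by
    ext j
    rw [← ENNReal.ofReal_natCast, ← ENNReal.ofReal_one, ← ENNReal.ofReal_add (by positivity)
      zero_le_one, ← ENNReal.ofReal_mul (Real.exp_nonneg _), ← Real.exp_nat_mul]
    ring_nf
  rw [this]
  exact hs.tsum_ofReal_ne_top

/-- Weak type `(1,1)` for the operator `h ↦ sup_{Q ∋ x} |b(x) - b_Q| |Q|⁻¹ ∫_Q h`. -/
lemma exists_volume_oscillation_mul_average_le (hn : n ≠ 0) {b : (Fin n → ℝ) → ℝ}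
    (hb : LocallyIntegrable b volume) {c : ℝ} (hc : 0 < c)
    (hexp : ∀ (z : Fin n → ℝ) (r : ℝ), 0 < r →
      ∫⁻ y in cube z r, ENNReal.ofReal (Real.exp (c * |b y - cubeMean b z r|)) ≤
        6 * volume (cube z r)) :
    ∃ C : ℝ≥0, ∀ h : (Fin n → ℝ) → ℝ≥0∞, ∫⁻ y, h y ≠ ∞ →
      volume {x | ∃ (z : Fin n → ℝ) (r : ℝ), 0 < r ∧ x ∈ cube z r ∧
        volume (cube z r) < ‖b x - cubeMean b z r‖ₑ * ∫⁻ y in cube z r, h y} ≤ C * ∫⁻ y, h y := by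
  set T := ∑' j : ℕ, ENNReal.ofReal (Real.exp (-(c / 2 * j))) * ((j : ℝ≥0∞) + 1) with hT
  have hTtop : T ≠ ∞ := tsum_exp_mul_ne_top (by positivity)
  have hDtop : (6 * (1 + 5 ^ n) : ℝ≥0∞) * 5 ^ n ≠ ∞ := by finiteness
  refine ⟨((6 * (1 + 5 ^ n) : ℝ≥0∞) * 5 ^ n * T).toNNReal, fun h hfin => ?_⟩
  rw [ENNReal.coe_toNNReal (ENNReal.mul_ne_top hDtop hTtop)]
  set E : ℕ → Set (Fin n → ℝ) := fun j => {x | ∃ (z : Fin n → ℝ) (r : ℝ), 0 < r ∧ x ∈ cube z r ∧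
    j ≤ |b x - cubeMean b z r| ∧ volume (cube z r) ≤ ∫⁻ y in cube z r, ((j : ℝ≥0∞) + 1) * h y}
    with hE
  have hjtop : ∀ j : ℕ, (j : ℝ≥0∞) + 1 ≠ ∞ := fun j => by finiteness
  have hEj : ∀ j, volume (E j) ≤ ENNReal.ofReal (Real.exp (-(c / 2 * j))) * (6 * (1 + 5 ^ n)) *
      5 ^ n * (((j : ℝ≥0∞) + 1) * ∫⁻ y, h y) := by
    intro j
    rw [← lintegral_const_mul' _ _ (hjtop j), ← setLIntegral_univ]
    -- Only the exceptional part of each cube 5q is needed: a cube Q ∋ x with Q ⊆ 5q and |b(x) -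
    -- b_Q| ≥ j puts x there. Its measure carries e^(-cj/2), which outweighs the factor j + 1 in the
    -- sum over j.
    refine vitali_bound hn (t := {p | 0 < p.2 ∧
      volume (cube p.1 p.2) ≤ ∫⁻ y in cube p.1 p.2, ((j : ℝ≥0∞) + 1) * h y}) (fun p hp => hp.1)
      (fun p _ => Set.subset_univ _)
      (by rw [setLIntegral_univ, lintegral_const_mul' _ _ (hjtop j)]
          exact ENNReal.mul_ne_top (hjtop j) hfin)
      (fun p hp => hp.2)
      (G := fun q => {x ∈ cube q.1 (5 * q.2) | ∃ (w : Fin n → ℝ) (ρ : ℝ), 0 < ρ ∧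
        cube w ρ ⊆ cube q.1 (5 * q.2) ∧ x ∈ cube w ρ ∧ j ≤ |b x - cubeMean b w ρ|}) ?_ ?_
    · intro q hq
      have h5 := volume_cube_mul q.1 q.1 hq.1 (k := 5) (by norm_num)
      refine (volume_large_oscillation_le hn hb hc.le hexp q.1 (r := 5 * q.2)
        (by linarith [hq.1]) j.cast_nonneg).trans ?_
      rw [mul_assoc _ (5 ^ n)]
      gcongr
      exact h5.le
    · rintro x ⟨z, r, hr, hx, hj, hle⟩
      exact ⟨(z, r), ⟨hr, hle⟩, fun q _ hq => ⟨hq hx, z, r, hr, hq, hx, hj⟩⟩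
  calc _ ≤ volume (⋃ j, E j) := by
        refine measure_mono ?_
        rintro x ⟨z, r, hr, hx, hlt⟩
        refine Set.mem_iUnion.2 ⟨⌊|b x - cubeMean b z r|⌋₊, z, r, hr, hx,
          Nat.floor_le (abs_nonneg _), ?_⟩
        rw [lintegral_const_mul' _ _ (hjtop _)]
        refine hlt.le.trans ?_
        gcongr
        rw [Real.enorm_eq_ofReal_abs]
        refine ENNReal.ofReal_le_of_le_toReal ?_
        rw [ENNReal.toReal_add (by finiteness) (by finiteness)]
        simpa using (Nat.lt_floor_add_one |b x - cubeMean b z r|).le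
    _ ≤ ∑' j, volume (E j) := measure_iUnion_le _
    _ ≤ ∑' j : ℕ, ((6 * (1 + 5 ^ n) : ℝ≥0∞) * 5 ^ n * ∫⁻ y, h y) *
          (ENNReal.ofReal (Real.exp (-(c / 2 * j))) * ((j : ℝ≥0∞) + 1)) := by
        refine ENNReal.tsum_le_tsum fun j => (hEj j).trans (le_of_eq ?_)
        ring
    _ = _ := by rw [ENNReal.tsum_mul_left, ← hT]; ring

lemma lintegral_mul_oscillation_le {b : (Fin n → ℝ) → ℝ} (hb : AEMeasurable b volume)
    {c : ℝ} (hc : 0 ≤ c)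
    (hexp : ∀ (z : Fin n → ℝ) (r : ℝ), 0 < r →
      ∫⁻ y in cube z r, ENNReal.ofReal (Real.exp (c * |b y - cubeMean b z r|)) ≤
        6 * volume (cube z r))
    {u : (Fin n → ℝ) → ℝ} (hu : ∀ y, 0 ≤ u y) (z : Fin n → ℝ) {r : ℝ} (hr : 0 < r) :
    ∫⁻ y in cube z r, ENNReal.ofReal (u y * (c * |b y - cubeMean b z r|)) ≤
      (∫⁻ y in cube z r, ENNReal.ofReal (youngFun (u y))) + 6 * volume (cube z r) := by
  have hE : AEMeasurable (fun y => ENNReal.ofReal (Real.exp (c * |b y - cubeMean b z r|)))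
      (volume.restrict (cube z r)) :=
    (((hb.sub_const _).restrict.abs.const_mul c).exp).ennreal_ofReal
  calc _ ≤ ∫⁻ y in cube z r, (ENNReal.ofReal (youngFun (u y)) +
        ENNReal.ofReal (Real.exp (c * |b y - cubeMean b z r|))) := by
        refine lintegral_mono fun y => ?_
        rw [← ENNReal.ofReal_add (youngFun_nonneg (hu y)) (Real.exp_nonneg _)]
        exact ENNReal.ofReal_le_ofReal (mul_le_youngFun_add_exp (hu y) (by positivity))
    _ = _ := lintegral_add_right' _ hE
    _ ≤ _ := by gcongr; exact hexp z r hr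

/-- Here 7 = 1 + 6: Young's inequality costs 6|Q| for the exponential, and what remains says that
Φ(u) has mean at least 1 over Q. -/
lemma volume_lintegral_mul_oscillation_le (hn : n ≠ 0) {b : (Fin n → ℝ) → ℝ}
    (hb : AEMeasurable b volume) {c : ℝ} (hc : 0 ≤ c)
    (hexp : ∀ (z : Fin n → ℝ) (r : ℝ), 0 < r →
      ∫⁻ y in cube z r, ENNReal.ofReal (Real.exp (c * |b y - cubeMean b z r|)) ≤
        6 * volume (cube z r))
    {u : (Fin n → ℝ) → ℝ} (hu : ∀ y, 0 ≤ u y) :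
    volume {x | ∃ (z : Fin n → ℝ) (r : ℝ), 0 < r ∧ x ∈ cube z r ∧ 7 * volume (cube z r) <
      ∫⁻ y in cube z r, ENNReal.ofReal (u y * (c * |b y - cubeMean b z r|))} ≤
        5 ^ n * ∫⁻ y, ENNReal.ofReal (youngFun (u y)) := by
  rw [← setLIntegral_univ]
  refine volume_le_of_maximal hn ?_
  rintro x ⟨z, r, hr, hx, hlt⟩
  refine ⟨z, r, hr, hx, Set.subset_univ _, ?_⟩
  have h1 := hlt.le.trans (lintegral_mul_oscillation_le hb hc hexp hu z hr)
  rw [show (7 : ℝ≥0∞) = 1 + 6 by norm_num, add_mul, one_mul] at h1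
  exact (ENNReal.add_le_add_iff_right (ENNReal.mul_ne_top (by finiteness)
    (volume_cube_ne_top z hr))).1 h1

lemma lintegral_commutator_le {b f : (Fin n → ℝ) → ℝ} (hf : AEMeasurable f volume)
    (E : Set (Fin n → ℝ)) (a m : ℝ) :
    ∫⁻ y in E, ‖a - b y‖ₑ * ‖f y‖ₑ ≤
      ‖a - m‖ₑ * (∫⁻ y in E, ‖f y‖ₑ) + ∫⁻ y in E, ‖b y - m‖ₑ * ‖f y‖ₑ := by
  rw [← lintegral_const_mul' _ _ (by finiteness), ← lintegral_add_left'
    (hf.enorm.const_mul _).restrict]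
  refine lintegral_mono fun y => ?_
  rw [← add_mul]
  gcongr
  calc ‖a - b y‖ₑ = ‖(a - m) + (m - b y)‖ₑ := by ring_nf
    _ ≤ ‖a - m‖ₑ + ‖m - b y‖ₑ := enorm_add_le _ _
    _ = _ := by rw [enorm_sub_rev m]

/-- The weak type `L (1 + log⁺ L)` estimate for the maximal commutator. -/
lemma exists_volume_maximalCommutator_le (hn : n ≠ 0) {b : (Fin n → ℝ) → ℝ}
    (hb : LocallyIntegrable b volume) {c : ℝ} (hc : 0 < c)
    (hexp : ∀ (z : Fin n → ℝ) (r : ℝ), 0 < r →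
      ∫⁻ y in cube z r, ENNReal.ofReal (Real.exp (c * |b y - cubeMean b z r|)) ≤
        6 * volume (cube z r)) :
    ∃ (C : ℝ≥0) (K : ℝ), 0 < K ∧ ∀ f : (Fin n → ℝ) → ℝ, AEMeasurable f volume → ∀ s : ℝ, 0 < s →
      volume {x | ENNReal.ofReal s < maximalCommutator b f x} ≤
        C * ∫⁻ y, ENNReal.ofReal (youngFun (K / s * |f y|)) := by
  have hbm : AEMeasurable b volume := hb.aestronglyMeasurable.aemeasurable
  obtain ⟨C, hC⟩ := exists_volume_oscillation_mul_average_le hn hb hc hexp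
  -- One of the two terms obtained by inserting b_Q must exceed s/2. With u = 14|f|/(cs) the second
  -- term does so when u·c|b - b_Q| has mean above 7; the first corresponds to h = 2|f|/s = (c/7)u ≤
  -- (c/7)Φ(u).
  refine ⟨C * (c / 7).toNNReal + 5 ^ n, 14 / c, by positivity, fun f hf s hs => ?_⟩
  set u : (Fin n → ℝ) → ℝ := fun y => 14 / c / s * |f y| with hu
  have hu0 : ∀ y, 0 ≤ u y := fun y => by positivity
  set J := ∫⁻ y, ENNReal.ofReal (youngFun (u y)) with hJ
  by_cases hJtop : J = ∞
  · rw [hJtop, ENNReal.mul_top (by simp)]; exact le_top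
  set h : (Fin n → ℝ) → ℝ≥0∞ := fun y => ENNReal.ofReal (2 / s) * ‖f y‖ₑ with hh
  have hhJ : ∫⁻ y, h y ≤ ENNReal.ofReal (c / 7) * J := by
    rw [hJ, ← lintegral_const_mul' _ _ ENNReal.ofReal_ne_top]
    refine lintegral_mono fun y => ?_
    simp only [hh]
    rw [← ofReal_mul_abs (by positivity), ← ENNReal.ofReal_mul (by positivity)]
    refine ENNReal.ofReal_le_ofReal ?_
    calc 2 / s * |f y| = c / 7 * u y := by simp only [hu]; field_simp; ring
      _ ≤ _ := by gcongr; exact le_youngFun (hu0 y)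
  have h1 := hC h (ne_top_of_le_ne_top (ENNReal.mul_ne_top ENNReal.ofReal_ne_top hJtop) hhJ)
  have h2 := volume_lintegral_mul_oscillation_le hn hbm hc.le hexp hu0
  have hsub : {x | ENNReal.ofReal s < maximalCommutator b f x} ⊆
      {x | ∃ (z : Fin n → ℝ) (r : ℝ), 0 < r ∧ x ∈ cube z r ∧
        volume (cube z r) < ‖b x - cubeMean b z r‖ₑ * ∫⁻ y in cube z r, h y} ∪
      {x | ∃ (z : Fin n → ℝ) (r : ℝ), 0 < r ∧ x ∈ cube z r ∧ 7 * volume (cube z r) <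
        ∫⁻ y in cube z r, ENNReal.ofReal (u y * (c * |b y - cubeMean b z r|))} := by
    intro x hx
    simp only [Set.mem_ofPred_eq, maximalCommutator, lt_iSup_iff] at hx
    obtain ⟨z, r, hr, hxz, hlt⟩ := hx
    by_contra hcon
    simp only [Set.mem_union, Set.mem_ofPred_eq, not_or, not_exists, not_and, not_lt] at hcon
    have h3 := hcon.1 z r hr hxz
    have h4 := hcon.2 z r hr hxz
    set V := volume (cube z r) with hV
    have hV0 : V ≠ 0 := volume_cube_ne_zero z hr
    have hVt : V ≠ ∞ := volume_cube_ne_top z hr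
    rw [mul_comm, ← div_eq_mul_inv, ENNReal.lt_div_iff_mul_lt (Or.inl hV0) (Or.inl hVt)] at hlt
    have h5 := hlt.trans_le (lintegral_commutator_le hf (cube z r) (b x) (cubeMean b z r))
    have h6 : ∫⁻ y in cube z r, ENNReal.ofReal (u y * (c * |b y - cubeMean b z r|)) =
        ENNReal.ofReal (14 / s) * ∫⁻ y in cube z r, ‖b y - cubeMean b z r‖ₑ * ‖f y‖ₑ := by
      rw [← lintegral_const_mul' _ _ ENNReal.ofReal_ne_top]
      refine lintegral_congr fun y => ?_
      rw [Real.enorm_eq_ofReal_abs, Real.enorm_eq_ofReal_abs, ← ENNReal.ofReal_mul (abs_nonneg _),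
        ← ENNReal.ofReal_mul (by positivity)]
      congr 1
      simp only [hu]
      field_simp
    have h7 : ENNReal.ofReal (14 / s) = 7 * ENNReal.ofReal (2 / s) := by
      rw [show (7 : ℝ≥0∞) = ENNReal.ofReal 7 by simp, ← ENNReal.ofReal_mul (by norm_num)]
      congr 1; ring
    have h8 : ENNReal.ofReal (14 / s) * ENNReal.ofReal s = 14 := by
      rw [← ENNReal.ofReal_mul (by positivity), div_mul_cancel₀ _ hs.ne']
      simp
    rw [hh, lintegral_const_mul' _ _ ENNReal.ofReal_ne_top] at h3
    have h9 := ENNReal.mul_lt_mul_right (a := ENNReal.ofReal (14 / s))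
      (by simpa using hs) ENNReal.ofReal_ne_top h5
    rw [← mul_assoc, h8, mul_add, ← h6] at h9
    refine absurd h9 (not_lt.2 ?_)
    calc _ = 7 * (‖b x - cubeMean b z r‖ₑ * (ENNReal.ofReal (2 / s) *
          ∫⁻ y in cube z r, ‖f y‖ₑ)) +
          ∫⁻ y in cube z r, ENNReal.ofReal (u y * (c * |b y - cubeMean b z r|)) := by
          rw [h7]; ring
      _ ≤ 7 * V + 7 * V := by gcongr
      _ = 14 * V := by ring
  calc _ ≤ C * (ENNReal.ofReal (c / 7) * J) + 5 ^ n * J :=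
        (measure_mono hsub).trans ((measure_union_le _ _).trans
          (add_le_add (h1.trans (by gcongr)) h2))
    _ = _ := by
        rw [ENNReal.coe_add, ENNReal.coe_mul, ENNReal.coe_pow]
        simp only [ENNReal.ofReal, ENNReal.coe_ofNat]
        ring

/-! ### Measurability and subadditivity of the maximal commutator -/

/-- A cube can be replaced by a cube of a countable family without decreasing the average. -/
lemma exists_rat_cube {F : (Fin n → ℝ) → ℝ≥0∞} {x z : Fin n → ℝ} {r : ℝ} (hr : 0 < r)
    (hx : x ∈ cube z r) {a : ℝ≥0∞} (ha : a < (volume (cube z r))⁻¹ * ∫⁻ y in cube z r, F y) :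
    ∃ (i : ℕ) (q : ℚ), (0 : ℝ) < q ∧ x ∈ cube (TopologicalSpace.denseSeq (Fin n → ℝ) i) q ∧
      a < (volume (cube (TopologicalSpace.denseSeq (Fin n → ℝ) i) q))⁻¹ *
        ∫⁻ y in cube (TopologicalSpace.denseSeq (Fin n → ℝ) i) q, F y := by
  set ρ : ℕ → ℝ := fun k => r - r / (k + 2) with hρ
  have hρlt : ∀ k : ℕ, r / ((k : ℝ) + 2) < r := fun k => by
    rw [div_lt_iff₀ (by positivity)]
    have : (0 : ℝ) ≤ k := k.cast_nonneg
    nlinarith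
  have hρpos : ∀ k, 0 < ρ k := fun k => sub_pos.2 (hρlt k)
  have hmono : Monotone fun k => cube z (ρ k) := by
    intro k l hkl
    refine cube_subset_cube (hρpos l) ?_
    have : (k : ℝ) ≤ l := by exact_mod_cast hkl
    rw [dist_self, zero_add]
    simp only [hρ]
    gcongr
  have hunion : ⋃ k, cube z (ρ k) = cube z r := by
    refine subset_antisymm (Set.iUnion_subset fun k => cube_subset_cube hr ?_) fun y hy => ?_
    · rw [dist_self, zero_add]
      simp only [hρ]
      have : 0 < r / ((k : ℝ) + 2) := by positivity
      linarith
    · have hd := (mem_cube_iff hr).1 hy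
      obtain ⟨k, hk⟩ := exists_nat_gt (r / (r - dist y z))
      refine Set.mem_iUnion.2 ⟨k, (mem_cube_iff (hρpos k)).2 ?_⟩
      rw [div_lt_iff₀ (sub_pos.2 hd)] at hk
      have h1 : r / ((k : ℝ) + 2) < r - dist y z := by
        rw [div_lt_iff₀ (by positivity)]
        nlinarith
      simp only [hρ]
      linarith
  have hx' := hx
  rw [← hunion] at hx'
  obtain ⟨k₁, hk₁⟩ := Set.mem_iUnion.1 hx'
  nth_rewrite 2 [← hunion] at ha
  rw [setLIntegral_iUnion_of_directed _ hmono.directed_le, ENNReal.mul_iSup, lt_iSup_iff] at ha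
  obtain ⟨k₂, hk₂⟩ := ha
  set k := max k₁ k₂
  have hxk : x ∈ cube z (ρ k) := hmono (le_max_left _ _) hk₁
  have hak : a < (volume (cube z r))⁻¹ * ∫⁻ y in cube z (ρ k), F y :=
    hk₂.trans_le (by gcongr; exact hmono (le_max_right _ _))
  set δ := r / ((k : ℝ) + 2) with hδ
  have hδpos : 0 < δ := by positivity
  obtain ⟨i, hi⟩ := (TopologicalSpace.denseRange_denseSeq (Fin n → ℝ)).exists_dist_lt z
    (show 0 < δ / 3 by positivity)
  -- With the centre moved by less than δ/3, such a radius puts the new cube between those of radii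
  -- r - δ and r about z. Lying inside the original cube, it has a normalising factor that is no
  -- smaller.
  obtain ⟨q, hq1, hq2⟩ := exists_rat_btwn (show r - 2 * δ / 3 < r - δ / 3 by linarith)
  have hρδ : ρ k = r - δ := rfl
  have hq0 : (0 : ℝ) < q := by linarith [hρpos k]
  have hs1 : cube z (ρ k) ⊆ cube (TopologicalSpace.denseSeq (Fin n → ℝ) i) q :=
    cube_subset_cube hq0 (by linarith)
  have hs2 : cube (TopologicalSpace.denseSeq (Fin n → ℝ) i) q ⊆ cube z r :=
    cube_subset_cube hr (by rw [dist_comm]; linarith)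
  exact ⟨i, q, hq0, hs1 hxk, hak.trans_le (by gcongr)⟩

lemma maximalCommutator_eq_iSup_rat (b f : (Fin n → ℝ) → ℝ) (x : Fin n → ℝ) :
    maximalCommutator b f x = ⨆ (i : ℕ) (q : ℚ) (_ : (0 : ℝ) < q),
      (cube (TopologicalSpace.denseSeq (Fin n → ℝ) i) q).indicator
        (fun x => (volume (cube (TopologicalSpace.denseSeq (Fin n → ℝ) i) q))⁻¹ *
          ∫⁻ y in cube (TopologicalSpace.denseSeq (Fin n → ℝ) i) q, ‖b x - b y‖ₑ * ‖f y‖ₑ) x := by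
  refine le_antisymm ?_ ?_
  · refine iSup₂_le fun z r => iSup₂_le fun hr hx => le_of_forall_lt fun a ha => ?_
    obtain ⟨i, q, hq, hxq, haq⟩ := exists_rat_cube hr hx ha
    refine haq.trans_le (le_iSup_of_le i (le_iSup_of_le q (le_iSup_of_le hq ?_)))
    rw [Set.indicator_of_mem hxq]
  · refine iSup_le fun i => iSup_le fun q => iSup_le fun hq => ?_
    refine Set.indicator_apply_le fun hx => ?_
    exact le_iSup₂_of_le _ _ (le_iSup₂_of_le hq hx le_rfl)

lemma measurable_maximalCommutator {b f : (Fin n → ℝ) → ℝ} (hb : Measurable b)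
    (hf : Measurable f) : Measurable (maximalCommutator b f) := by
  rw [show maximalCommutator b f = _ from funext (maximalCommutator_eq_iSup_rat b f)]
  refine Measurable.iSup fun i => Measurable.iSup fun q => Measurable.iSup fun _ => ?_
  refine Measurable.indicator ?_ (measurableSet_cube _ _)
  refine Measurable.const_mul (Measurable.lintegral_prod_right' (f := fun p : (Fin n → ℝ) ×
    (Fin n → ℝ) => ‖b p.1 - b p.2‖ₑ * ‖f p.2‖ₑ) ?_) _
  fun_prop

/-- Changing b and f on null sets leaves the integrals alone and affects C_b at x only through the
value b(x). -/
lemma aemeasurable_maximalCommutator {b f : (Fin n → ℝ) → ℝ} (hb : AEMeasurable b volume)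
    (hf : AEMeasurable f volume) : AEMeasurable (maximalCommutator b f) volume := by
  refine ⟨_, measurable_maximalCommutator hb.measurable_mk hf.measurable_mk, ?_⟩
  filter_upwards [hb.ae_eq_mk] with x hx
  simp only [maximalCommutator]
  refine iSup_congr fun z => iSup_congr fun r => iSup_congr fun _ => iSup_congr fun _ => ?_
  congr 1
  refine lintegral_congr_ae (ae_restrict_of_ae ?_)
  filter_upwards [hb.ae_eq_mk, hf.ae_eq_mk] with y hy hy'
  rw [hx, hy, hy']

lemma maximalCommutator_le_indicator_add {b f : (Fin n → ℝ) → ℝ} (hb : AEMeasurable b volume)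
    (hf : AEMeasurable f volume) {S : Set (Fin n → ℝ)} (hS : MeasurableSet S) (x : Fin n → ℝ) :
    maximalCommutator b f x ≤ maximalCommutator b (S.indicator f) x +
      maximalCommutator b (Sᶜ.indicator f) x := by
  refine iSup₂_le fun z r => iSup₂_le fun hr hx => ?_
  have h1 : ∫⁻ y in cube z r, ‖b x - b y‖ₑ * ‖f y‖ₑ =
      (∫⁻ y in cube z r, ‖b x - b y‖ₑ * ‖S.indicator f y‖ₑ) +
        ∫⁻ y in cube z r, ‖b x - b y‖ₑ * ‖Sᶜ.indicator f y‖ₑ := by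
    have hm : AEMeasurable (fun y => ‖b x - b y‖ₑ * ‖S.indicator f y‖ₑ)
        (volume.restrict (cube z r)) :=
      ((hb.const_sub _).enorm.mul (hf.indicator hS).enorm).restrict
    rw [← lintegral_add_left' hm]
    refine lintegral_congr fun y => ?_
    by_cases hy : y ∈ S
    · simp [hy]
    · simp [hy]
  rw [h1, mul_add]
  exact add_le_add (le_iSup₂_of_le z r (le_iSup₂_of_le hr hx le_rfl))
    (le_iSup₂_of_le z r (le_iSup₂_of_le hr hx le_rfl))

/-! ### Boundedness of the maximal commutator -/

/-- Taking β strictly above the norm yields an admissible α below β(2r)^(-λ) without asking whether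
the infimum is attained. -/
lemma lintegral_youngFun_le_of_zygmundMorreyNorm_lt (hn : n ≠ 0) {lam β : ℝ} (hβ : 0 < β)
    {f : (Fin n → ℝ) → ℝ} (hf : zygmundMorreyNorm lam f < ENNReal.ofReal β)
    (z : Fin n → ℝ) {r : ℝ} (hr : 0 < r) :
    ∫⁻ y in cube z r, ENNReal.ofReal (youngFun (|f y| / (β * (2 * r) ^ (-lam)))) ≤
      volume (cube z r) := by
  have h2r : 0 < 2 * r := by positivity
  have hpow : 0 < (2 * r) ^ (-lam) := Real.rpow_pos_of_pos h2r _
  have h1 : ENNReal.ofReal ((2 * r) ^ lam) * zygmundAverage f (cube z r) < ENNReal.ofReal β := by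
    rw [← volume_cube_rpow hn lam z hr]
    refine lt_of_le_of_lt ?_ hf
    exact le_iSup₂_of_le z r (le_iSup_of_le hr le_rfl)
  have h2 : zygmundAverage f (cube z r) < ENNReal.ofReal (β * (2 * r) ^ (-lam)) := by
    by_contra hcon
    rw [not_lt] at hcon
    refine absurd h1 (not_lt.2 (le_trans (le_of_eq ?_) (mul_le_mul_right hcon _)))
    rw [← ENNReal.ofReal_mul (by positivity), mul_left_comm, ← Real.rpow_add h2r, add_neg_cancel,
      Real.rpow_zero, mul_one]
  simp only [zygmundAverage, iInf_lt_iff] at h2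
  obtain ⟨α, hα, h3, h4⟩ := h2
  rw [mul_comm, ← div_eq_mul_inv, ENNReal.div_le_iff (volume_cube_ne_zero z hr)
    (volume_cube_ne_top z hr), one_mul] at h3
  refine le_trans (lintegral_mono fun y => ENNReal.ofReal_le_ofReal ?_) h3
  refine youngFun_mono (by positivity) ?_
  have h5 : (α : ℝ) ≤ β * (2 * r) ^ (-lam) := by
    rw [← ENNReal.ofReal_coe_nnreal] at h4
    exact ((ENNReal.ofReal_lt_ofReal_iff (by positivity)).1 h4).le
  have : (0 : ℝ) < α := by exact_mod_cast hα
  gcongr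

/-- The maximal commutator on a cube of a function vanishing on the three times larger cube. -/
lemma maximalCommutator_compl_cube_le {b : (Fin n → ℝ) → ℝ}
    (hb : LocallyIntegrable b volume) {c : ℝ} (hc : 0 < c)
    (hexp : ∀ (z : Fin n → ℝ) (r : ℝ), 0 < r →
      ∫⁻ y in cube z r, ENNReal.ofReal (Real.exp (c * |b y - cubeMean b z r|)) ≤
        6 * volume (cube z r))
    {lam β : ℝ} (hlam : 0 < lam) (hβ : 0 < β) {f : (Fin n → ℝ) → ℝ} (hf : AEMeasurable f volume)
    (hfβ : ∀ (z : Fin n → ℝ) (r : ℝ), 0 < r →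
      ∫⁻ y in cube z r, ENNReal.ofReal (youngFun (|f y| / (β * (2 * r) ^ (-lam)))) ≤
        volume (cube z r))
    {x z : Fin n → ℝ} {r : ℝ} (hr : 0 < r) (hx : x ∈ cube z r) :
    ENNReal.ofReal c * maximalCommutator b ((cube z (3 * r))ᶜ.indicator f) x ≤
      3 ^ n * ENNReal.ofReal (β * (2 * r) ^ (-lam)) *
        (ENNReal.ofReal (c * |b x - cubeMean b z r|) + ENNReal.ofReal (n / lam) + 13) := by
  have hbm : AEMeasurable b volume := hb.aestronglyMeasurable.aemeasurable
  have hxz := (mem_cube_iff hr).1 hx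
  simp only [maximalCommutator, ENNReal.mul_iSup]
  refine iSup₂_le fun w ρ => iSup₂_le fun hρ hxw => ?_
  have hxw' := (mem_cube_iff hρ).1 hxw
  -- A cube through x of radius at most r lies in 3Q, where the function vanishes. A larger one lies
  -- in P, which is concentric with Q.
  rcases le_or_gt ρ r with hρr | hρr
  · have h0 : ∫⁻ y in cube w ρ, ‖b x - b y‖ₑ * ‖(cube z (3 * r))ᶜ.indicator f y‖ₑ = 0 := by
      rw [← lintegral_zero (μ := volume.restrict (cube w ρ))]
      refine setLIntegral_congr_fun (measurableSet_cube _ _) fun y hy => ?_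
      have hyw := (mem_cube_iff hρ).1 hy
      have : y ∈ cube z (3 * r) := by
        rw [mem_cube_iff (by positivity)]
        have h1 := dist_triangle4 y w x z
        rw [dist_comm w x] at h1
        linarith
      simp [this]
    rw [h0, mul_zero, mul_zero]
    exact zero_le
  have h3ρ : 0 < 3 * ρ := by positivity
  set P := cube z (3 * ρ) with hP
  set mP := cubeMean b z (3 * ρ) with hmP
  set a := β * (2 * r) ^ (-lam) with ha
  set aP := β * (2 * (3 * ρ)) ^ (-lam) with haP
  have haP0 : 0 < aP := by positivity
  have ha0 : 0 < a := by positivity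
  have hQP : cube w ρ ⊆ P := by
    refine cube_subset_cube h3ρ ?_
    have h1 := dist_triangle w x z
    rw [dist_comm w x] at h1
    linarith
  have hvolP : volume P = 3 ^ n * volume (cube w ρ) :=
    volume_cube_mul z w hρ (k := 3) (by norm_num)
  have hfP : ∫⁻ y in P, ‖f y‖ₑ ≤ ENNReal.ofReal aP * volume P := by
    refine le_trans ?_ (mul_le_mul_right (hfβ z (3 * ρ) h3ρ) _)
    rw [← lintegral_const_mul' _ _ ENNReal.ofReal_ne_top]
    refine lintegral_mono fun y => ?_
    rw [← ENNReal.ofReal_mul haP0.le, Real.enorm_eq_ofReal_abs]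
    refine ENNReal.ofReal_le_ofReal ?_
    calc |f y| = aP * (|f y| / aP) := by field_simp
      _ ≤ _ := by gcongr; exact le_youngFun (by positivity)
  have hbfP : ENNReal.ofReal c * ∫⁻ y in P, ‖b y - mP‖ₑ * ‖f y‖ₑ ≤
      ENNReal.ofReal aP * (7 * volume P) := by
    have h1 := lintegral_mul_oscillation_le hbm hc.le hexp (u := fun y => |f y| / aP)
      (fun y => by positivity) z h3ρ
    have h2 : (7 : ℝ≥0∞) * volume P = volume P + 6 * volume P := by ring
    rw [h2]
    refine le_trans (le_of_eq ?_) (mul_le_mul_right (h1.trans (add_le_add_left (hfβ z _ h3ρ) _)) _)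
    rw [← lintegral_const_mul' _ _ ENNReal.ofReal_ne_top,
      ← lintegral_const_mul' _ _ ENNReal.ofReal_ne_top]
    refine lintegral_congr fun y => ?_
    rw [Real.enorm_eq_ofReal_abs, Real.enorm_eq_ofReal_abs, ← ENNReal.ofReal_mul (abs_nonneg _),
      ← ENNReal.ofReal_mul (by positivity), ← ENNReal.ofReal_mul (by positivity)]
    congr 1
    field_simp
    exact mul_comm _ _
  have hy1 : 1 ≤ 3 * ρ / r := by rw [one_le_div hr]; linarith
  set m := n * Real.log (3 * ρ / r) with hm
  have hm0 : 0 ≤ m := mul_nonneg n.cast_nonneg (Real.log_nonneg hy1)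
  have hmean : ENNReal.ofReal (c * |b x - mP|) ≤
      ENNReal.ofReal (c * |b x - cubeMean b z r|) + (ENNReal.ofReal m + 6) := by
    have h1 : ENNReal.ofReal (c * |cubeMean b z r - mP|) ≤ ENNReal.ofReal m + 6 := by
      refine ofReal_mul_abs_cubeMean_sub_cubeMean_le hb hc.le hexp h3ρ hr hm0
        (cube_subset_cube h3ρ (by rw [dist_self]; linarith)) (le_of_eq ?_)
      rw [volume_cube z h3ρ, volume_cube z hr, hm, Real.exp_nat_mul, Real.exp_log (by positivity),
        ← ENNReal.ofReal_mul (by positivity), ← mul_pow]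
      congr 2
      field_simp
    refine le_trans ?_ (add_le_add_right h1 _)
    rw [← ENNReal.ofReal_add (by positivity) (by positivity), ← mul_add]
    exact ENNReal.ofReal_le_ofReal (by gcongr; exact abs_sub_le _ _ _)
  have haPa : aP = a * (3 * ρ / r) ^ (-lam) := by
    rw [haP, ha, mul_assoc, ← Real.mul_rpow (by positivity) (by positivity)]
    congr 2
    field_simp
  have haP_le : aP ≤ a := by
    rw [haPa]
    exact mul_le_of_le_one_right ha0.le (Real.rpow_le_one_of_one_le_of_nonpos hy1 (by linarith))
  -- Power decay against logarithmic drift: y^(-λ) log y ≤ 1/λ with y = 3ρ/r, uniformly in ρ.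
  have haPm : aP * m ≤ a * (n / lam) := by
    rw [haPa, mul_assoc]
    refine mul_le_mul_of_nonneg_left ?_ ha0.le
    have h1 := Real.log_le_rpow_div (x := 3 * ρ / r) (by positivity) hlam
    have h2 : (3 * ρ / r) ^ (-lam) * (3 * ρ / r) ^ lam = 1 := by
      rw [← Real.rpow_add (by positivity)]; simp
    calc (3 * ρ / r) ^ (-lam) * m
        ≤ (3 * ρ / r) ^ (-lam) * (n * ((3 * ρ / r) ^ lam / lam)) := by rw [hm]; gcongr
      _ = ((3 * ρ / r) ^ (-lam) * (3 * ρ / r) ^ lam) * (n / lam) := by ring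
      _ = n / lam := by rw [h2, one_mul]
  -- The constant 13 is 6 from the drift of the means plus 7 from Young's inequality on P; 3^n is
  -- the volume ratio.
  have hmain : ENNReal.ofReal c * ∫⁻ y in cube w ρ,
      ‖b x - b y‖ₑ * ‖(cube z (3 * r))ᶜ.indicator f y‖ₑ ≤
      3 ^ n * ENNReal.ofReal a *
        (ENNReal.ofReal (c * |b x - cubeMean b z r|) + ENNReal.ofReal (n / lam) + 13) *
          volume (cube w ρ) := by
    calc _ ≤ ENNReal.ofReal c * ∫⁻ y in P, ‖b x - b y‖ₑ * ‖f y‖ₑ := by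
          refine mul_le_mul_right ?_ _
          refine (lintegral_mono_set hQP).trans (lintegral_mono fun y => ?_)
          gcongr
          exact enorm_indicator_le_enorm_self _ _
      _ ≤ ENNReal.ofReal c * (‖b x - mP‖ₑ * (∫⁻ y in P, ‖f y‖ₑ) +
            ∫⁻ y in P, ‖b y - mP‖ₑ * ‖f y‖ₑ) := by
          gcongr
          exact lintegral_commutator_le hf _ _ _
      _ = ENNReal.ofReal (c * |b x - mP|) * (∫⁻ y in P, ‖f y‖ₑ) +
            ENNReal.ofReal c * ∫⁻ y in P, ‖b y - mP‖ₑ * ‖f y‖ₑ := by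
          rw [mul_add, ofReal_mul_abs hc.le, mul_assoc]
      _ ≤ (ENNReal.ofReal (c * |b x - cubeMean b z r|) + (ENNReal.ofReal m + 6)) *
            (ENNReal.ofReal aP * volume P) + ENNReal.ofReal aP * (7 * volume P) := by gcongr
      _ = (ENNReal.ofReal aP * ENNReal.ofReal (c * |b x - cubeMean b z r|) +
            ENNReal.ofReal aP * ENNReal.ofReal m + ENNReal.ofReal aP * 13) * volume P := by ring
      _ ≤ (ENNReal.ofReal a * ENNReal.ofReal (c * |b x - cubeMean b z r|) +
            ENNReal.ofReal a * ENNReal.ofReal (n / lam) + ENNReal.ofReal a * 13) * volume P := by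
          have h1 := ENNReal.ofReal_le_ofReal haP_le
          have h2 : ENNReal.ofReal aP * ENNReal.ofReal m ≤
              ENNReal.ofReal a * ENNReal.ofReal (n / lam) := by
            rw [← ENNReal.ofReal_mul haP0.le, ← ENNReal.ofReal_mul ha0.le]
            exact ENNReal.ofReal_le_ofReal haPm
          gcongr
      _ = _ := by rw [hvolP]; ring
  rw [mul_left_comm, mul_comm, ← div_eq_mul_inv, ENNReal.div_le_iff (volume_cube_ne_zero w hρ)
    (volume_cube_ne_top w hρ)]
  exact hmain

lemma exists_weakZygmundAverage_le (hn : n ≠ 0) {b : (Fin n → ℝ) → ℝ}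
    (hb : LocallyIntegrable b volume) {c : ℝ} (hc : 0 < c)
    (hexp : ∀ (z : Fin n → ℝ) (r : ℝ), 0 < r →
      ∫⁻ y in cube z r, ENNReal.ofReal (Real.exp (c * |b y - cubeMean b z r|)) ≤
        6 * volume (cube z r)) {lam : ℝ} (hlam : 0 < lam) :
    ∃ A : ℝ, 0 < A ∧ ∀ (f : (Fin n → ℝ) → ℝ) (β : ℝ), AEMeasurable f volume → 0 < β →
      zygmundMorreyNorm lam f < ENNReal.ofReal β → ∀ (z : Fin n → ℝ) (r : ℝ), 0 < r →
        weakZygmundAverage (maximalCommutator b f) (cube z r) ≤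
          ENNReal.ofReal (A * (β * (2 * r) ^ (-lam))) := by
  have hbm : AEMeasurable b volume := hb.aestronglyMeasurable.aemeasurable
  obtain ⟨C, K, hK, hweak⟩ := exists_volume_maximalCommutator_le hn hb hc hexp
  -- Here 19 = 13 + 6, the 6 bounding the mean of c|b - b_Q|. In A, the terms 2B and 4CK3^n make the
  -- far and local parts at most |Q|/(2t) each, and 2K ensures 2K/(At) ≤ 1 for t > 1.
  set B : ℝ := 2 * 3 ^ n * (n / lam + 19) / c with hB
  have hB0 : 0 < B := by positivity
  set A : ℝ := 2 * B + 4 * C * K * 3 ^ n + 2 * K with hA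
  have hC0 : (0 : ℝ) ≤ C := C.coe_nonneg
  have hCK : 0 ≤ 4 * C * K * 3 ^ n := by positivity
  have hA0 : 0 < A := by positivity
  refine ⟨A, hA0, fun f β hf hβ hfβ z r hr => ?_⟩
  have hyoung := fun (w : Fin n → ℝ) (ρ : ℝ) (hρ : 0 < ρ) =>
    lintegral_youngFun_le_of_zygmundMorreyNorm_lt hn hβ hfβ w hρ
  set a := β * (2 * r) ^ (-lam) with ha
  have ha0 : 0 < a := by positivity
  have h3r : 0 < 3 * r := by positivity
  have hV0 := volume_cube_ne_zero z hr
  have hVt := volume_cube_ne_top z hr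
  refine iInf_le_of_le (A * a).toNNReal (iInf_le_of_le (by simpa using mul_pos hA0 ha0)
    (iInf_le_of_le (iSup₂_le fun t ht => ?_) le_rfl))
  have ht' : (0 : ℝ) < t := by exact_mod_cast ht
  have hAat : (((A * a).toNNReal : ℝ≥0) : ℝ≥0∞) * (t : ℝ≥0∞) = ENNReal.ofReal (A * a * t) := by
    rw [ENNReal.ofReal_mul (by positivity) (q := (t : ℝ)), ENNReal.ofReal_coe_nnreal]; rfl
  rw [hAat]
  have hΦ : 0 < youngFun (1 / (t : ℝ)) :=
    (by positivity : (0 : ℝ) < 1 / t).trans_le (le_youngFun (by positivity))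
  suffices hvol : volume {x ∈ cube z r | ENNReal.ofReal (A * a * t) < maximalCommutator b f x} ≤
      ENNReal.ofReal (youngFun (1 / (t : ℝ))) * volume (cube z r) by
    rw [mul_comm, ← div_eq_mul_inv, ENNReal.div_le_iff hV0 hVt, one_mul, ENNReal.div_le_iff
      (by simpa using hΦ) ENNReal.ofReal_ne_top]
    exact hvol.trans_eq (mul_comm _ _)
  -- For t ≤ 1 the weak condition is free, since Φ(1/t) ≥ 1; for t > 1 it asks only for a weak L¹
  -- bound.
  rcases le_or_gt (t : ℝ) 1 with ht1 | ht1
  · refine (measure_mono fun x hx => hx.1).trans (le_mul_of_one_le_left' ?_)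
    rw [ENNReal.one_le_ofReal]
    exact le_trans (by rw [le_div_iff₀ ht']; linarith) (le_youngFun (by positivity))
  rw [youngFun_of_le_one (by positivity) (by rw [div_le_one ht']; exact ht1.le)]
  set f₁ := (cube z (3 * r)).indicator f with hf₁
  set f₂ := (cube z (3 * r))ᶜ.indicator f with hf₂
  set s : ℝ := A * a * t / 2 with hs
  have hs0 : 0 < s := by positivity
  -- the local part
  have hlocal : volume {x | ENNReal.ofReal s < maximalCommutator b f₁ x} ≤
      ENNReal.ofReal (1 / (2 * t)) * volume (cube z r) := by
    refine (hweak f₁ (hf.indicator (measurableSet_cube _ _)) s hs0).trans ?_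
    have h1 : ∫⁻ y, ENNReal.ofReal (youngFun (K / s * |f₁ y|)) =
        ∫⁻ y in cube z (3 * r), ENNReal.ofReal (youngFun (K / s * |f y|)) := by
      rw [← lintegral_indicator (measurableSet_cube _ _)]
      refine lintegral_congr fun y => ?_
      by_cases hy : y ∈ cube z (3 * r)
      · simp [hf₁, hy]
      · simp [hf₁, hy, youngFun_zero]
    have hε1 : 2 * K / (A * t) ≤ 1 := by
      rw [div_le_one (by positivity)]
      nlinarith
    have ha3 : β * (2 * (3 * r)) ^ (-lam) ≤ a := by
      rw [ha]
      refine mul_le_mul_of_nonneg_left ?_ hβ.le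
      exact Real.rpow_le_rpow_of_nonpos (by positivity) (by linarith) (by linarith)
    have h2 : ∫⁻ y in cube z (3 * r), ENNReal.ofReal (youngFun (K / s * |f y|)) ≤
        ENNReal.ofReal (2 * K / (A * t)) * volume (cube z (3 * r)) := by
      refine le_trans ?_ (mul_le_mul_right (hyoung z (3 * r) h3r) _)
      rw [← lintegral_const_mul' _ _ ENNReal.ofReal_ne_top]
      refine lintegral_mono fun y => ?_
      rw [← ENNReal.ofReal_mul (by positivity)]
      refine ENNReal.ofReal_le_ofReal (le_trans ?_
        (youngFun_mul_le (by positivity) hε1 (by positivity)))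
      refine youngFun_mono (by positivity) ?_
      calc K / s * |f y| = 2 * K / (A * t) * (|f y| / a) := by rw [hs]; field_simp
        _ ≤ _ := by gcongr
    have h3 : volume (cube z (3 * r)) = ENNReal.ofReal (3 ^ n) * volume (cube z r) := by
      rw [ENNReal.ofReal_pow (by norm_num), ENNReal.ofReal_ofNat]
      exact volume_cube_mul z z hr (k := 3) (by norm_num)
    rw [h1]
    refine (mul_le_mul_right h2 _).trans ?_
    rw [h3, ← ENNReal.ofReal_coe_nnreal, ← mul_assoc, ← mul_assoc,
      ← ENNReal.ofReal_mul hC0, ← ENNReal.ofReal_mul (by positivity)]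
    gcongr
    rw [mul_div_assoc', div_mul_eq_mul_div, div_le_div_iff₀ (by positivity) (by positivity)]
    have : 4 * C * K * 3 ^ n ≤ A := by rw [hA]; linarith
    nlinarith
  -- the part far away
  set m := cubeMean b z r with hm
  set g : (Fin n → ℝ) → ℝ≥0∞ := fun x => ENNReal.ofReal (2 * 3 ^ n / (c * (A * t))) *
    (ENNReal.ofReal (c * |b x - m|) + ENNReal.ofReal (n / lam) + 13) with hg
  have hgm : AEMeasurable g volume :=
    ((((hbm.sub_const m).abs.const_mul c).ennreal_ofReal.add_const _).add_const _).const_mul _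
  have hfar : volume {x ∈ cube z r | ENNReal.ofReal s < maximalCommutator b f₂ x} ≤
      ENNReal.ofReal (1 / (2 * t)) * volume (cube z r) := by
    have hsub : {x ∈ cube z r | ENNReal.ofReal s < maximalCommutator b f₂ x} ⊆
        {x ∈ cube z r | 1 ≤ g x} := by
      rintro x ⟨hx, hlt⟩
      refine ⟨hx, ?_⟩
      have h1 := maximalCommutator_compl_cube_le hb hc hexp hlam hβ hf hyoung hr hx
      have h2 := (mul_le_mul_right hlt.le (ENNReal.ofReal c)).trans h1
      have h3 := mul_le_mul_right h2 (ENNReal.ofReal (2 / (c * (A * a * t))))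
      have h4 : ENNReal.ofReal (2 / (c * (A * a * t))) * (ENNReal.ofReal c * ENNReal.ofReal s) =
          1 := by
        rw [← ENNReal.ofReal_mul hc.le, ← ENNReal.ofReal_mul (by positivity), ← ENNReal.ofReal_one]
        congr 1
        rw [hs]
        field_simp
      rw [h4, ← mul_assoc] at h3
      refine h3.trans (le_of_eq ?_)
      simp only [hg]
      congr 1
      rw [show (3 : ℝ≥0∞) ^ n = ENNReal.ofReal (3 ^ n) by
        rw [ENNReal.ofReal_pow (by norm_num), ENNReal.ofReal_ofNat],
        ← ENNReal.ofReal_mul (by positivity), ← ENNReal.ofReal_mul (by positivity)]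
      congr 1
      field_simp
      exact ha.symm
    refine (measure_mono hsub).trans
      ((volume_le_setLIntegral hgm _ (measurableSet_cube z r)).trans ?_)
    have h5 : ∫⁻ x in cube z r, ENNReal.ofReal (c * |b x - m|) ≤ 6 * volume (cube z r) := by
      refine le_trans (lintegral_mono fun x => ENNReal.ofReal_le_ofReal ?_) (hexp z r hr)
      linarith [Real.add_one_le_exp (c * |b x - m|)]
    have h6 : ENNReal.ofReal (n / lam + 19) = 6 + ENNReal.ofReal (n / lam) + 13 := by
      rw [ENNReal.ofReal_add (by positivity) (by norm_num), ENNReal.ofReal_ofNat]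
      ring
    calc ∫⁻ x in cube z r, g x = ENNReal.ofReal (2 * 3 ^ n / (c * (A * t))) *
          ((∫⁻ x in cube z r, ENNReal.ofReal (c * |b x - m|)) +
            ENNReal.ofReal (n / lam) * volume (cube z r) + 13 * volume (cube z r)) := by
          rw [hg, lintegral_const_mul' _ _ ENNReal.ofReal_ne_top,
            lintegral_add_right _ measurable_const, lintegral_add_right _ measurable_const,
            setLIntegral_const, setLIntegral_const]
      _ ≤ ENNReal.ofReal (2 * 3 ^ n / (c * (A * t))) *
          (ENNReal.ofReal (n / lam + 19) * volume (cube z r)) := by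
          have h7 : (6 + ENNReal.ofReal (n / lam) + 13) * volume (cube z r) =
              6 * volume (cube z r) + ENNReal.ofReal (n / lam) * volume (cube z r) +
                13 * volume (cube z r) := by ring
          rw [h6, h7]
          gcongr
      _ ≤ _ := by
          rw [← mul_assoc, ← ENNReal.ofReal_mul (by positivity)]
          gcongr
          have h7 : 2 * 3 ^ n / (c * (A * t)) * (n / lam + 19) = B / (A * t) := by
            rw [hB]; field_simp
          rw [h7, div_le_div_iff₀ (by positivity) (by positivity)]
          have : 2 * B ≤ A := by rw [hA]; linarith
          nlinarith
  calc _ ≤ volume ({x | ENNReal.ofReal s < maximalCommutator b f₁ x} ∪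
        {x ∈ cube z r | ENNReal.ofReal s < maximalCommutator b f₂ x}) := by
        refine measure_mono ?_
        rintro x ⟨hx, hlt⟩
        by_contra hcon
        simp only [Set.mem_union, Set.mem_ofPred_eq, not_or, not_and, not_lt] at hcon
        refine absurd hlt (not_lt.2 ((maximalCommutator_le_indicator_add hbm hf
          (measurableSet_cube z (3 * r)) x).trans
          ((add_le_add hcon.1 (hcon.2 hx)).trans (le_of_eq ?_))))
        rw [← ENNReal.ofReal_add hs0.le hs0.le, hs, add_halves]
    _ ≤ ENNReal.ofReal (1 / (2 * t)) * volume (cube z r) +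
        ENNReal.ofReal (1 / (2 * t)) * volume (cube z r) :=
        (measure_union_le _ _).trans (add_le_add hlocal hfar)
    _ = _ := by
        rw [← add_mul, ← ENNReal.ofReal_add (by positivity) (by positivity)]
        congr 2
        field_simp
        norm_num

lemma MemBMO.boundedToWeak (hn : n ≠ 0) {b : (Fin n → ℝ) → ℝ} (h : MemBMO b) {lam : ℝ}
    (hlam : 0 < lam) : BoundedToWeak lam (maximalCommutator b) := by
  obtain ⟨hb, hN⟩ := h
  have hbm : AEMeasurable b volume := hb.aestronglyMeasurable.aemeasurable
  obtain ⟨N, hN'⟩ := ENNReal.lt_iff_exists_coe.1 hN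
  have hosc : ∀ (z : Fin n → ℝ) (r : ℝ), 0 < r →
      ∫⁻ y in cube z r, ‖b y - cubeMean b z r‖ₑ ≤ N * volume (cube z r) := by
    intro z r hr
    rw [← ENNReal.div_le_iff (volume_cube_ne_zero z hr) (volume_cube_ne_top z hr),
      div_eq_mul_inv, mul_comm, ← hN'.1]
    exact le_iSup₂_of_le z r (le_iSup_of_le hr le_rfl)
  obtain ⟨c, hc, hexp⟩ := exists_lintegral_exp_le hn hb hosc
  obtain ⟨A, hA, hAf⟩ := exists_weakZygmundAverage_le hn hb hc hexp hlam
  have hbound : ∀ f : (Fin n → ℝ) → ℝ, MemZygmundMorrey lam f →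
      weakZygmundMorreyNorm lam (maximalCommutator b f) ≤
        ENNReal.ofReal A * zygmundMorreyNorm lam f := by
    rintro f ⟨hf, hfin⟩
    have hlt : ∀ β : ℝ≥0, zygmundMorreyNorm lam f < β →
        weakZygmundMorreyNorm lam (maximalCommutator b f) ≤ ENNReal.ofReal A * β := by
      intro β hβ
      have hβ0 : (0 : ℝ) < β := by exact_mod_cast (zero_le.trans_lt hβ)
      refine iSup₂_le fun z r => iSup_le fun hr => ?_
      have h2r : 0 < 2 * r := by positivity
      rw [volume_cube_rpow hn lam z hr]
      refine (mul_le_mul_right (hAf f β hf hβ0 (by rwa [ENNReal.ofReal_coe_nnreal]) z r hr)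
        _).trans (le_of_eq ?_)
      rw [← ENNReal.ofReal_mul (by positivity), ← ENNReal.ofReal_coe_nnreal,
        ← ENNReal.ofReal_mul hA.le]
      congr 1
      calc (2 * r) ^ lam * (A * (β * (2 * r) ^ (-lam)))
          = A * β * ((2 * r) ^ lam * (2 * r) ^ (-lam)) := by ring
        _ = A * β := by rw [← Real.rpow_add h2r]; simp
    have hA0 : ENNReal.ofReal A ≠ 0 := by simpa using hA
    rw [← ENNReal.div_le_iff' hA0 ENNReal.ofReal_ne_top]
    -- Letting β decrease to the norm also covers functions of norm zero.
    refine le_of_forall_gt fun x hx => ?_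
    obtain ⟨β, hβ1, hβ2⟩ := ENNReal.lt_iff_exists_nnreal_btwn.1 hx
    refine lt_of_le_of_lt ?_ hβ2
    rw [ENNReal.div_le_iff' hA0 ENNReal.ofReal_ne_top]
    exact hlt β hβ1
  refine ⟨A.toNNReal, fun f hf => ⟨⟨aemeasurable_maximalCommutator hbm hf.1, ?_⟩, hbound f hf⟩⟩
  exact (hbound f hf).trans_lt (ENNReal.mul_lt_top ENNReal.ofReal_lt_top hf.2)

/-! ### Necessity of bounded mean oscillation -/

lemma zygmundAverage_le {f : (Fin n → ℝ) → ℝ} {z : Fin n → ℝ} {r α : ℝ} (hr : 0 < r) (hα : 0 < α)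
    (h : ∫⁻ y in cube z r, ENNReal.ofReal (youngFun (|f y| / α)) ≤ volume (cube z r)) :
    zygmundAverage f (cube z r) ≤ ENNReal.ofReal α := by
  refine iInf_le_of_le α.toNNReal (iInf_le_of_le (by simpa using hα) (iInf_le_of_le ?_ le_rfl))
  rw [Real.coe_toNNReal α hα.le, mul_comm, ← div_eq_mul_inv,
    ENNReal.div_le_iff (volume_cube_ne_zero z hr) (volume_cube_ne_top z hr), one_mul]
  exact h

/-- From 1 ≤ y^(d-λ) and log y ≤ y^(d-λ)/(d-λ) one gets 1 + λ log y ≤ (1 + λ/(d-λ)) y^(d-λ), and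
this constant is d/(d-λ). -/
lemma youngFun_rpow_div_le {lam d : ℝ} (hlam : 0 < lam) (hd : lam < d) {y : ℝ} (hy : 1 ≤ y) :
    youngFun (y ^ lam / (d / (d - lam))) ≤ y ^ d := by
  have hdl : 0 < d - lam := by linarith
  have hd0 : 0 < d := by linarith
  have hy0 : 0 < y := by linarith
  have hC1 : (d / (d - lam))⁻¹ ≤ 1 := by
    rw [inv_div, div_le_one hd0]; linarith
  have h1 : 1 ≤ y ^ lam := Real.one_le_rpow hy hlam.le
  have h2 : 1 ≤ y ^ (d - lam) := Real.one_le_rpow hy hdl.le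
  have h3 : Real.log y ≤ y ^ (d - lam) / (d - lam) := Real.log_le_rpow_div hy0.le hdl
  have h4 : Real.posLog (y ^ lam) = lam * Real.log y := by
    rw [Real.posLog_eq_log (by rw [abs_of_pos (by positivity)]; exact h1), Real.log_rpow hy0]
  calc youngFun (y ^ lam / (d / (d - lam))) = youngFun ((d / (d - lam))⁻¹ * y ^ lam) := by
        rw [div_eq_inv_mul]
    _ ≤ (d / (d - lam))⁻¹ * youngFun (y ^ lam) :=
        youngFun_mul_le (by positivity) hC1 (by positivity)
    _ ≤ (d / (d - lam))⁻¹ * (y ^ lam * (d / (d - lam) * y ^ (d - lam))) := by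
        unfold youngFun
        rw [h4]
        gcongr
        calc 1 + lam * Real.log y ≤ y ^ (d - lam) + lam * (y ^ (d - lam) / (d - lam)) := by gcongr
          _ = _ := by field_simp; ring
    _ = y ^ lam * y ^ (d - lam) := by field_simp
    _ = y ^ d := by rw [← Real.rpow_add hy0]; congr 1; ring

/-- On cubes no larger than Q, α = 1 is admissible. On larger ones α = C(r/ρ)^λ is, because
Φ((ρ/r)^λ/C) is at most the volume ratio (ρ/r)^n. -/
lemma zygmundMorreyNorm_indicator_cube_le {lam : ℝ} (hlam : 0 < lam) (hlam_lt : lam < n)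
    (z : Fin n → ℝ) {r : ℝ} (hr : 0 < r) :
    zygmundMorreyNorm lam ((cube z r).indicator fun _ => 1) ≤
      ENNReal.ofReal (n / (n - lam) * (2 * r) ^ lam) := by
  have hn : n ≠ 0 := by
    rintro rfl
    simp only [Nat.cast_zero] at hlam_lt
    linarith
  have hdl : 0 < (n : ℝ) - lam := by linarith
  have hn0 : (0 : ℝ) < n := by linarith
  have hC1 : 1 ≤ (n : ℝ) / (n - lam) := by rw [one_le_div hdl]; linarith
  refine iSup₂_le fun w ρ => iSup_le fun hρ => ?_
  rw [volume_cube_rpow hn lam w hρ]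
  have hint : ∀ α : ℝ, ∫⁻ y in cube w ρ,
      ENNReal.ofReal (youngFun (|(cube z r).indicator (fun _ => (1 : ℝ)) y| / α)) =
        ENNReal.ofReal (youngFun (1 / α)) * volume (cube z r ∩ cube w ρ) := by
    intro α
    rw [← Measure.restrict_apply (measurableSet_cube z r),
      ← lintegral_indicator_const (measurableSet_cube z r)]
    refine lintegral_congr fun y => ?_
    by_cases hy : y ∈ cube z r
    · simp [hy]
    · simp [hy, youngFun_zero]
  rcases le_or_gt ρ r with hρr | hρr
  · have h1 : zygmundAverage ((cube z r).indicator fun _ => 1) (cube w ρ) ≤ ENNReal.ofReal 1 := by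
      refine zygmundAverage_le hρ one_pos ?_
      rw [hint, div_one, youngFun_one, ENNReal.ofReal_one, one_mul]
      exact measure_mono Set.inter_subset_right
    refine (mul_le_mul_right h1 _).trans ?_
    rw [← ENNReal.ofReal_mul (by positivity), mul_one]
    refine ENNReal.ofReal_le_ofReal ?_
    calc (2 * ρ) ^ lam ≤ (2 * r) ^ lam := by gcongr
      _ ≤ _ := le_mul_of_one_le_left (by positivity) hC1
  · set C : ℝ := n / (n - lam) with hC
    have hC0 : 0 < C := by positivity
    have h1 : zygmundAverage ((cube z r).indicator fun _ => 1) (cube w ρ) ≤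
        ENNReal.ofReal (C * (r / ρ) ^ lam) := by
      refine zygmundAverage_le hρ (by positivity) ?_
      have h2 : 1 / (C * (r / ρ) ^ lam) = (ρ / r) ^ lam / C := by
        rw [← inv_div ρ r, Real.inv_rpow (by positivity)]
        field_simp
      have h3 : youngFun ((ρ / r) ^ lam / C) ≤ (ρ / r) ^ n := by
        rw [← Real.rpow_natCast]
        exact youngFun_rpow_div_le hlam hlam_lt (by rw [one_le_div hr]; exact hρr.le)
      rw [hint, h2]
      refine (mul_le_mul' (ENNReal.ofReal_le_ofReal h3)
        (measure_mono Set.inter_subset_left)).trans (le_of_eq ?_)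
      rw [volume_cube z hr, volume_cube w hρ, ← ENNReal.ofReal_mul (by positivity), ← mul_pow]
      congr 2
      field_simp
    refine (mul_le_mul_right h1 _).trans (le_of_eq ?_)
    rw [← ENNReal.ofReal_mul (by positivity), mul_left_comm,
      ← Real.mul_rpow (by positivity) (by positivity)]
    congr 3
    field_simp

/-- Boundedness of the maximal commutator bounds the oscillation of `b` around one of its values. -/
lemma BoundedToWeak.exists_lintegral_sub_le {lam : ℝ} (hlam : 0 < lam) (hlam_lt : lam < n)
    {b : (Fin n → ℝ) → ℝ} (h : BoundedToWeak lam (maximalCommutator b)) :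
    ∃ L : ℝ≥0, ∀ (z : Fin n → ℝ) (r : ℝ), 0 < r →
      ∃ x, ∫⁻ y in cube z r, ‖b y - b x‖ₑ ≤ L * volume (cube z r) := by
  have hn : n ≠ 0 := by
    rintro rfl
    simp only [Nat.cast_zero] at hlam_lt
    linarith
  obtain ⟨C, hC⟩ := h
  set D : ℝ≥0 := C * ((n : ℝ) / (n - lam)).toNNReal with hD
  refine ⟨2 * (D + 1), fun z r hr => ?_⟩
  have h2r : 0 < 2 * r := by positivity
  have hV0 := volume_cube_ne_zero z hr
  have hVt := volume_cube_ne_top z hr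
  have hpow : ENNReal.ofReal ((2 * r) ^ lam) ≠ 0 := by
    simpa using Real.rpow_pos_of_pos h2r lam
  set f : (Fin n → ℝ) → ℝ := (cube z r).indicator fun _ => 1 with hf
  have hnorm := zygmundMorreyNorm_indicator_cube_le hlam hlam_lt z hr
  obtain ⟨-, hb⟩ := hC f ⟨(measurable_const.indicator (measurableSet_cube z r)).aemeasurable,
    hnorm.trans_lt ENNReal.ofReal_lt_top⟩
  have havg : weakZygmundAverage (maximalCommutator b f) (cube z r) ≤ D := by
    have h1 : ENNReal.ofReal ((2 * r) ^ lam) *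
        weakZygmundAverage (maximalCommutator b f) (cube z r) ≤
          ENNReal.ofReal ((2 * r) ^ lam) * D := by
      rw [← volume_cube_rpow hn lam z hr]
      have h0 : volume (cube z r) ^ (lam / n) *
          weakZygmundAverage (maximalCommutator b f) (cube z r) ≤
            weakZygmundMorreyNorm lam (maximalCommutator b f) :=
        le_iSup₂_of_le z r (le_iSup_of_le hr le_rfl)
      refine h0.trans (hb.trans ((mul_le_mul_right hnorm _).trans (le_of_eq ?_)))
      rw [volume_cube_rpow hn lam z hr, hD,
        ENNReal.ofReal_mul (div_nonneg n.cast_nonneg (by linarith)), ENNReal.coe_mul,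
        ENNReal.ofReal]
      ring
    exact (ENNReal.mul_le_mul_iff_right hpow ENNReal.ofReal_ne_top).1 h1
  have hlt : weakZygmundAverage (maximalCommutator b f) (cube z r) < ((D + 1 : ℝ≥0) : ℝ≥0∞) :=
    havg.trans_lt (by exact_mod_cast lt_add_one D)
  simp only [weakZygmundAverage, iInf_lt_iff] at hlt
  obtain ⟨α, -, hα, hαD⟩ := hlt
  -- At t = 2 one has Φ(1/t) = 1/2, so the set where C_b(1_Q) > 2α fills at most half of Q and
  -- misses some x.
  have h2 := (le_iSup₂ (f := fun (t : ℝ≥0) (_ : 0 < t) => (volume (cube z r))⁻¹ *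
    (volume {x ∈ cube z r | (α : ℝ≥0∞) * (t : ℝ≥0∞) < maximalCommutator b f x} /
      ENNReal.ofReal (youngFun (1 / (t : ℝ))))) 2 two_pos).trans hα
  simp only [NNReal.coe_ofNat, ENNReal.coe_ofNat] at h2
  rw [youngFun_of_le_one (by norm_num) (by norm_num), mul_comm, ← div_eq_mul_inv,
    ENNReal.div_le_iff hV0 hVt, one_mul, ENNReal.div_le_iff (by simp) ENNReal.ofReal_ne_top] at h2
  have h3 : volume {x ∈ cube z r | (α : ℝ≥0∞) * 2 < maximalCommutator b f x} <
      volume (cube z r) := by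
    refine h2.trans_lt ?_
    rw [ENNReal.ofReal_div_of_pos two_pos, ENNReal.ofReal_one, ENNReal.ofReal_ofNat,
      one_div, ← div_eq_mul_inv]
    exact ENNReal.half_lt_self hV0 hVt
  obtain ⟨x, hx, hxα⟩ : ∃ x ∈ cube z r, maximalCommutator b f x ≤ α * 2 := by
    by_contra hcon
    push Not at hcon
    refine h3.ne (congrArg volume (subset_antisymm (fun x hx => hx.1) fun x hx => ⟨hx, hcon x hx⟩))
  refine ⟨x, ?_⟩
  have h4 : (volume (cube z r))⁻¹ * ∫⁻ y in cube z r, ‖b x - b y‖ₑ * ‖f y‖ₑ ≤ α * 2 := by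
    refine le_trans ?_ hxα
    exact le_iSup₂_of_le z r (le_iSup₂_of_le hr hx le_rfl)
  rw [mul_comm, ← div_eq_mul_inv, ENNReal.div_le_iff hV0 hVt] at h4
  calc ∫⁻ y in cube z r, ‖b y - b x‖ₑ = ∫⁻ y in cube z r, ‖b x - b y‖ₑ * ‖f y‖ₑ := by
        refine setLIntegral_congr_fun (measurableSet_cube _ _) fun y hy => ?_
        simp [hf, hy, enorm_sub_rev]
    _ ≤ α * 2 * volume (cube z r) := h4
    _ ≤ _ := by
        rw [ENNReal.coe_mul, mul_comm (α : ℝ≥0∞)]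
        gcongr
        exact le_rfl

/-- Passing from b(x) to b_Q costs a factor 2, as |b_Q - b(x)| is at most the mean of |b - b(x)|.
The same bound on cubes of radius 1 yields local integrability. -/
lemma BoundedToWeak.memBMO {lam : ℝ} (hlam : 0 < lam) (hlam_lt : lam < n)
    {b : (Fin n → ℝ) → ℝ} (hb : AEMeasurable b volume)
    (h : BoundedToWeak lam (maximalCommutator b)) : MemBMO b := by
  obtain ⟨L, hL⟩ := h.exists_lintegral_sub_le hlam hlam_lt
  have hloc : LocallyIntegrable b volume := by
    intro w
    refine ⟨cube w 1, (isOpen_cube w 1).mem_nhds (mem_cube_self w one_pos), ?_⟩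
    obtain ⟨x, hx⟩ := hL w 1 one_pos
    have h1 : IntegrableOn (fun y => b y - b x) (cube w 1) :=
      ⟨(hb.sub_const _).aestronglyMeasurable.restrict,
        hx.trans_lt (ENNReal.mul_lt_top ENNReal.coe_lt_top (volume_cube_ne_top w one_pos).lt_top)⟩
    refine (h1.add (integrableOn_const (C := b x) (volume_cube_ne_top w one_pos))).congr_fun
      (fun y _ => ?_) (measurableSet_cube w 1)
    simp
  refine ⟨hloc, lt_of_le_of_lt (iSup₂_le fun z r => iSup_le fun hr => ?_)
    (ENNReal.coe_lt_top (r := 2 * L))⟩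
  obtain ⟨x, hx⟩ := hL z r hr
  rw [mul_comm, ← div_eq_mul_inv,
    ENNReal.div_le_iff (volume_cube_ne_zero z hr) (volume_cube_ne_top z hr)]
  refine (lintegral_sub_const_le b _ (b x) (cubeMean b z r)).trans ?_
  rw [enorm_sub_rev]
  refine (add_le_add hx ((enorm_cubeMean_sub_mul_le hloc z hr _).trans hx)).trans (le_of_eq ?_)
  rw [ENNReal.coe_mul, ENNReal.coe_ofNat]
  ring

end ZygmundMorrey

theorem mainTheorem1 (n : ℕ) (lam : ℝ) (hlam : 0 < lam) (hlam_lt : lam < n)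
    (b : (Fin n → ℝ) → ℝ) (hb : AEMeasurable b MeasureTheory.volume) :
    ZygmundMorrey.MemBMO b ↔
      ZygmundMorrey.BoundedToWeak lam (ZygmundMorrey.maximalCommutator b) := by
  refine ⟨fun h => h.boundedToWeak ?_ hlam, fun h => h.memBMO hlam hlam_lt hb⟩
  rintro rfl
  simp only [Nat.cast_zero] at hlam_lt
  linarith
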